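/- Let $(\Omega,\mathcal A,\mathbb P)$ be a probability space. Let $\{T_{i,j}\}_{(i,j)\in\mathbb Z^2}$ be an Abelian group of bimeasurable, measure-preserving bijections of $\Omega$, with $T_{0,0}=\mathrm{id}$ and $T_{i,j}\circ T_{k,l}=T_{i+k,j+l}$. Let $\{\mathcal F_{i,j}\}_{(i,j)\in\mathbb Z^2}$ be a family of sub-$\sigma$-algebras of $\mathcal A$ that is a filtration ($\mathcal F_{i,j}\subset\mathcal F_{k,l}$ whenever $i\le k$ and $j\le l$), that is commuting (for every bounded $\mathcal F_{k,l}$-measurable $Y$, $\mathbb E(Y\mid\mathcal F_{i,j})=\mathbb E(Y\mid\mathcal F_{i\wedge k,\,j\wedge l})$ almost surely), and that satisfies $T_{-i,-j}\mathcal F_{k,l}=\mathcal F_{k+i,l+j}$ for all $(i,j),(k,l)\in\mathbb Z^2$. Put $$\mathcal F_{i,\infty}=\bigvee_{j\ge 0}\mathcal F_{i,j},\quad \mathcal F_{\infty,j}=\bigvee_{i\ge 0}\mathcal F_{i,j},\quad \mathcal F_{\infty,\infty}=\bigvee_{(i,j)\in\mathbb Z^2}\mathcal F_{i,j},\quad \mathcal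 F_{-\infty,\infty}=\bigcap_{i\in\mathbb Z}\mathcal F_{i,\infty},\quad \mathcal F_{\infty,-\infty}=\bigcap_{j\in\mathbb Z}\mathcal F_{\infty,j}.$$ For a real random variable $f$ write $S_{m,n}=S_{m,n}(f)=\sum_{i=1}^m\sum_{j=1}^n f\circ T_{i,j}$, and let $\|\cdot\|_p$ be the norm of $L^p(\mathbb P)$. **Proposition.** For every real $p\ge 2$ there is a constant $C<\infty$, depending only on $p$, such that for all $(\Omega,\mathcal A,\mathbb P)$, $\{T_{i,j}\}$, $\{\mathcal F_{i,j}\}$ as above, all $f\in L^p(\mathcal F_{\infty,\infty})$ with $\mathbb E(f\mid\mathcal F_{-\infty,\infty})=\mathbb E(f\mid\mathcal F_{\infty,-\infty})=0$ almost surely, and all $m,n\in\mathbb N$, $$\|S_{m,n}\|_p\le C\,m^{1/2}n^{1/2}\sum_{k=1}^m\sum_{l=1}^n\frac{d_{k,l}(f)}{k^{3/2}\,l^{3/2}},$$ where $$\begin{aligned}d_{k,l}(f)={}&\|\mathbb E(S_{k,l}\mid\mathcal F_{1,1})\|_p+\|\mathbb E(S_{k,l}\mid\mathcal F_{1,\infty})-\mathbb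 E(S_{k,l}\mid\mathcal F_{1,l})\|_p+\|\mathbb E(S_{k,l}\mid\mathcal F_{\infty,1})-\mathbb E(S_{k,l}\mid\mathcal F_{k,1})\|_p\\&+\|S_{k,l}-\mathbb E(S_{k,l}\mid\mathcal F_{k,\infty})-\mathbb E(S_{k,l}\mid\mathcal F_{\infty,l})+\mathbb E(S_{k,l}\mid\mathcal F_{k,l})\|_p.\end{aligned}$$ -/

import Mathlib

open MeasureTheory Finset
open scoped ENNReal NNReal

universe u

noncomputable section

namespace RandomField

variable {Ω : Type*} {mΩ : MeasurableSpace Ω}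

/-- A two-parameter filtration `ℱ` (increasing for the coordinatewise order on `ℤ × ℤ`) is
commuting if `E(Y | ℱ_{i,j}) = E(Y | ℱ_{i ∧ k, j ∧ l})` almost surely, for every bounded
`ℱ_{k,l}`-measurable random variable `Y`. -/
def IsCommuting (ℱ : Filtration (ℤ × ℤ) mΩ) (μ : Measure Ω) : Prop :=
  ∀ (i j k l : ℤ) (Y : Ω → ℝ), Measurable[ℱ (k, l)] Y → (∃ M : ℝ, ∀ ω, |Y ω| ≤ M) →
    μ[Y | ℱ (i, j)] =ᵐ[μ] μ[Y | ℱ (min i k, min j l)]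

/-- `(T_{i,j})` is an abelian group, indexed by `ℤ × ℤ`, of bimeasurable bijections of `Ω` that
preserve `μ`. -/
structure IsShiftGroup (T : ℤ × ℤ → Ω ≃ᵐ Ω) (μ : Measure Ω) : Prop where
  map_zero : ∀ ω, T 0 ω = ω
  map_add : ∀ a b ω, T (a + b) ω = T a (T b ω)
  measurePreserving : ∀ a, MeasurePreserving (T a) μ μ

/-- The shifts carry the filtration along: `T_{-i,-j} ℱ_{k,l} = ℱ_{k+i,l+j}`. For a group of
bijections, `T_{-i,-j} ℱ_{k,l} = {T_{-i,-j} A : A ∈ ℱ_{k,l}}` is the σ-algebra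
`{T_{i,j}⁻¹ A : A ∈ ℱ_{k,l}}`, i.e. the pullback of `ℱ_{k,l}` under `T_{i,j}`. -/
def IsCompatible (T : ℤ × ℤ → Ω ≃ᵐ Ω) (ℱ : Filtration (ℤ × ℤ) mΩ) : Prop :=
  ∀ i j k l : ℤ, (ℱ (k, l)).comap (T (i, j)) = ℱ (k + i, l + j)

/-- `ℱ_{i,∞}`, generated by the `ℱ_{i,j}` with `j ≥ 0`. -/
def sigmaTop₂ (ℱ : Filtration (ℤ × ℤ) mΩ) (i : ℤ) : MeasurableSpace Ω :=
  ⨆ (j : ℤ) (_ : 0 ≤ j), ℱ (i, j)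

/-- `ℱ_{∞,j}`, generated by the `ℱ_{i,j}` with `i ≥ 0`. -/
def sigmaTop₁ (ℱ : Filtration (ℤ × ℤ) mΩ) (j : ℤ) : MeasurableSpace Ω :=
  ⨆ (i : ℤ) (_ : 0 ≤ i), ℱ (i, j)

/-- `ℱ_{∞,∞}`, generated by all the `ℱ_{i,j}`. -/
def sigmaTopTop (ℱ : Filtration (ℤ × ℤ) mΩ) : MeasurableSpace Ω :=
  ⨆ a : ℤ × ℤ, ℱ a

/-- `ℱ_{-∞,∞} = ⋂ i, ℱ_{i,∞}`. -/
def sigmaBotTop (ℱ : Filtration (ℤ × ℤ) mΩ) : MeasurableSpace Ω :=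
  ⨅ i : ℤ, sigmaTop₂ ℱ i

/-- `ℱ_{∞,-∞} = ⋂ j, ℱ_{∞,j}`. -/
def sigmaTopBot (ℱ : Filtration (ℤ × ℤ) mΩ) : MeasurableSpace Ω :=
  ⨅ j : ℤ, sigmaTop₁ ℱ j

/-- `S_{m,n}(f) = ∑_{i=1}^m ∑_{j=1}^n f ∘ T_{i,j}`. -/
def partialSum (T : ℤ × ℤ → Ω ≃ᵐ Ω) (f : Ω → ℝ) (m n : ℕ) : Ω → ℝ :=
  fun ω => ∑ i ∈ Icc 1 m, ∑ j ∈ Icc 1 n, f (T ((i : ℤ), (j : ℤ)) ω)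

/-- The projective quantity `d_{k,l}(f)`, a sum of four `L^p(μ)`-norms (with values in
`[0, ∞]`). -/
def projTerm (μ : Measure Ω) (T : ℤ × ℤ → Ω ≃ᵐ Ω) (ℱ : Filtration (ℤ × ℤ) mΩ) (p : ℝ≥0∞)
    (f : Ω → ℝ) (k l : ℕ) : ℝ≥0∞ :=
  eLpNorm (μ[partialSum T f k l | ℱ (1, 1)]) p μ
  + eLpNorm (μ[partialSum T f k l | sigmaTop₂ ℱ 1]
      - μ[partialSum T f k l | ℱ (1, (l : ℤ))]) p μ
  + eLpNorm (μ[partialSum T f k l | sigmaTop₁ ℱ 1]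
      - μ[partialSum T f k l | ℱ ((k : ℤ), 1)]) p μ
  + eLpNorm (partialSum T f k l
      - μ[partialSum T f k l | sigmaTop₂ ℱ (k : ℤ)]
      - μ[partialSum T f k l | sigmaTop₁ ℱ (l : ℤ)]
      + μ[partialSum T f k l | ℱ ((k : ℤ), (l : ℤ))]) p μ

end RandomField

end

/-! The proof is a one-parameter maximal-free Peligrad–Utev argument, valid without adaptedness,
used once in each direction. In one parameter, let `S_n` be the sum of the first `n` shifts, `P_i`
the conditional expectation on level `i`, and `w_n = ‖P_1 S_n‖ + ‖S_n - P_n S_n‖`. Up to an error of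
size `w_n`, `S_n` is `D_n = P_n S_n - P_0 S_n`, a martingale difference for blocks of length `n`.
Merging two blocks of length `h` gives `D_{2h} = D_h + T_h D_h + M_h` with `‖M_h‖ ≤ 2 w_h`, and
`M_h` is itself a martingale difference for blocks of length `2h`. Iterating, `D_{2^r}` is a sum
over dyadic scales of stationary martingale differences. For `p ≥ 2` the norm of `L^p` is 2-smooth
along these (`exists_smooth_const`), so `N` of them cost only a factor `√N`; hence `‖S_{2^r}‖` is at
most a constant times `2^{r/2} ∑_{s ≤ r} w_{2^s} / 2^{s/2}`. Binary expansion treats general `n`,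
and the near subadditivity of `w` replaces dyadic terms by the full series with weights `k^{-3/2}`
(`norm_shiftSum_le`). In two parameters, take `P₁ i = E(· | ℱ_{i,∞})` and `P₂ j = E(· | ℱ_{∞,j})`.
Since `P₁` commutes with the vertical shifts, both pieces of the horizontal `w_k` are again vertical
sums, to which the one-parameter bound applies (`norm_shiftSum_shiftSum_le`). Commutation of the
filtration gives `P₂ j (P₁ i x) = E(x | ℱ_{i,j})` (`IsCommuting.condExp_condExp`), which identifies
the four resulting norms with `d_{k,l}` (`projTerm_eq`). -/

namespace RandomField

/-! ### A Peligrad–Utev type inequality in a normed space -/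

section Abstract

variable {X : Type*} [NormedAddCommGroup X]

/-- An increasing family `P` of contractive commuting projections of a normed space, carried along
by a semigroup `T` of isometries, such that the norm is 2-smooth (with constant `K`) along martingale
differences. -/
structure IsSmoothSystem (P : ℤ → X →+ X) (T : ℕ → X →+ X) (K : ℝ) : Prop where
  proj_proj : ∀ i j x, P i (P j x) = P (min i j) x
  norm_proj_le : ∀ i x, ‖P i x‖ ≤ ‖x‖
  shift_zero : ∀ x, T 0 x = x
  shift_add : ∀ i j x, T (i + j) x = T i (T j x)
  norm_shift : ∀ i x, ‖T i x‖ = ‖x‖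
  shift_proj : ∀ (i : ℕ) (j : ℤ) x, T i (P j x) = P (j + i) (T i x)
  one_le : 1 ≤ K
  smooth : ∀ i x y, P i x = x → P i y = 0 → ‖x + y‖ ^ 2 ≤ ‖x‖ ^ 2 + K * ‖y‖ ^ 2

/-- The sum `T 1 x + ⋯ + T n x`. -/
def shiftSum (T : ℕ → X →+ X) (n : ℕ) (x : X) : X := ∑ j ∈ Icc 1 n, T j x

/-- The size of the part of `T 1 x + ⋯ + T k x` that is not a martingale difference. -/
noncomputable def projNorm (P : ℤ → X →+ X) (T : ℕ → X →+ X) (k : ℕ) (x : X) : ℝ :=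
  ‖P 1 (shiftSum T k x)‖ + ‖shiftSum T k x - P k (shiftSum T k x)‖

/-- The martingale-difference part of the sum over a block of length `n`. -/
def blockDiff (P : ℤ → X →+ X) (T : ℕ → X →+ X) (n : ℕ) (x : X) : X :=
  P n (shiftSum T n x) - P 0 (shiftSum T n x)

/-- The correction that appears when two adjacent blocks of length `h` are merged. -/
def mergeDiff (P : ℤ → X →+ X) (T : ℕ → X →+ X) (h : ℕ) (x : X) : X :=
  (P (h + h : ℕ) (shiftSum T h x) - P h (shiftSum T h x))
    + (P h (T h (shiftSum T h x)) - P 0 (T h (shiftSum T h x)))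

/-- Dyadic means of a nonnegative sequence, weighted by `2 ^ (-3 s / 2)`, are controlled by the
series of the sequence with weights `k ^ (-3 / 2)`. -/
lemma sum_dyadic_le {w : ℕ → ℝ} (hw : ∀ k, 0 ≤ w k) (r : ℕ) :
    ∑ s ∈ range (r + 1), (∑ k ∈ Icc 1 (2 ^ s), w k) / (√2 ^ 3) ^ s
      ≤ 2 * ∑ k ∈ Icc 1 (2 ^ r), w k / (k : ℝ) ^ (3 / 2 : ℝ) := by
  have hd : 2 ≤ √2 ^ 3 := by
    have h1 : 1 ≤ √2 := Real.one_le_sqrt.2 (by norm_num)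
    have h2 : √2 ^ 2 = 2 := Real.sq_sqrt (by norm_num)
    nlinarith
  have hIcc : ∀ n, Icc 1 n = Ioc 0 n := fun n => by ext; simp; omega
  have hk : ∀ s k : ℕ, k ≤ 2 ^ s → (k : ℝ) ^ (3 / 2 : ℝ) ≤ (√2 ^ 3) ^ s := by
    intro s k h
    rw [show (3 / 2 : ℝ) = (1 / 2 : ℝ) * (3 : ℕ) by norm_num, Real.rpow_mul (by positivity),
      ← Real.sqrt_eq_rpow, Real.rpow_natCast, ← pow_mul, mul_comm 3 s, pow_mul]
    refine pow_le_pow_left₀ (by positivity) ?_ 3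
    refine Real.sqrt_le_left (by positivity) |>.2 ?_
    rw [← pow_mul, mul_comm s 2, pow_mul, Real.sq_sqrt (by norm_num)]
    exact_mod_cast h
  set d := √2 ^ 3 with hd'
  have hd0 : 0 < d := by linarith
  -- Abel summation: with `A_s` the inner sums, the left side is `A_0 + ∑_{1 ≤ s ≤ r} (A_s -
  -- A_{s-1}) / d^s`, and `k^{3/2} ≤ d^s` on the block of `A_s - A_{s-1}`. As `d ≥ 2`, the factor `1
  -- - d⁻¹` is at least `1/2`.
  have key : (1 - d⁻¹) * ∑ s ∈ range (r + 1), (∑ k ∈ Icc 1 (2 ^ s), w k) / d ^ s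
      + (∑ k ∈ Icc 1 (2 ^ r), w k) / d ^ (r + 1)
      ≤ ∑ k ∈ Icc 1 (2 ^ r), w k / (k : ℝ) ^ (3 / 2 : ℝ) := by
    induction r with
    | zero => simp; apply le_of_eq; ring
    | succ r ih =>
      have hle : 2 ^ r ≤ 2 ^ (r + 1) := Nat.pow_le_pow_right (by norm_num) (by omega)
      have s1 := Finset.sum_Ioc_consecutive w (Nat.zero_le _) hle
      have s2 := Finset.sum_Ioc_consecutive (fun k : ℕ => w k / (k : ℝ) ^ (3 / 2 : ℝ))
        (Nat.zero_le _) hle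
      have s3 : (∑ k ∈ Ioc (2 ^ r) (2 ^ (r + 1)), w k) / d ^ (r + 1)
          ≤ ∑ k ∈ Ioc (2 ^ r) (2 ^ (r + 1)), w k / (k : ℝ) ^ (3 / 2 : ℝ) := by
        rw [Finset.sum_div]
        refine Finset.sum_le_sum fun k hk' => ?_
        rw [mem_Ioc] at hk'
        have : 0 < (k : ℝ) := by exact_mod_cast (Nat.zero_le _).trans_lt hk'.1
        exact div_le_div_of_nonneg_left (hw k) (by positivity) (hk _ _ hk'.2)
      rw [Finset.sum_range_succ]
      simp only [hIcc] at ih ⊢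
      rw [← s2, ← s1]
      set A := ∑ k ∈ Ioc 0 (2 ^ r), w k
      set B := ∑ k ∈ Ioc (2 ^ r) (2 ^ (r + 1)), w k
      have e : (1 - d⁻¹) * ((A + B) / d ^ (r + 1)) + (A + B) / d ^ (r + 1 + 1)
          = A / d ^ (r + 1) + B / d ^ (r + 1) := by
        rw [pow_succ d (r + 1)]
        field_simp
        ring
      rw [mul_add]
      linarith
  have hS : 0 ≤ ∑ s ∈ range (r + 1), (∑ k ∈ Icc 1 (2 ^ s), w k) / d ^ s :=
    Finset.sum_nonneg fun s _ => div_nonneg (Finset.sum_nonneg fun k _ => hw k) (by positivity)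
  have hE : 0 ≤ (∑ k ∈ Icc 1 (2 ^ r), w k) / d ^ (r + 1) :=
    div_nonneg (Finset.sum_nonneg fun k _ => hw k) (by positivity)
  have hinv : d⁻¹ ≤ 1 / 2 := by
    rw [one_div]; exact inv_anti₀ (by norm_num) hd
  nlinarith

variable {P : ℤ → X →+ X} {T : ℕ → X →+ X} {K : ℝ}

lemma projNorm_nonneg (k : ℕ) (x : X) : 0 ≤ projNorm P T k x := by
  unfold projNorm; positivity

namespace IsSmoothSystem

variable (H : IsSmoothSystem P T K)
include H

lemma shiftSum_add (m n : ℕ) (x : X) :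
    shiftSum T (m + n) x = shiftSum T m x + T m (shiftSum T n x) := by
  induction n with
  | zero => simp [shiftSum]
  | succ n ih =>
    have h1 : shiftSum T (m + (n + 1)) x = shiftSum T (m + n) x + T (m + (n + 1)) x := by
      unfold shiftSum
      rw [← add_assoc, Finset.sum_Icc_succ_top (by omega)]
    have h2 : shiftSum T (n + 1) x = shiftSum T n x + T (n + 1) x := by
      unfold shiftSum
      rw [Finset.sum_Icc_succ_top (by omega)]
    rw [h1, h2, ih, map_add, H.shift_add m (n + 1), add_assoc]

lemma proj_eq_of_le {i j : ℤ} (h : i ≤ j) {x : X} (hx : P i x = x) : P j x = x := by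
  rw [← hx, H.proj_proj, min_eq_right h]

/-- The factor 2 comes from `1 - P`, which has norm at most 2 but need not be a contraction. -/
lemma projNorm_add_le (i j : ℕ) (x : X) :
    projNorm P T (i + j) x ≤ 2 * (projNorm P T i x + projNorm P T j x) := by
  have e1 : P 1 (shiftSum T (i + j) x)
      = P 1 (shiftSum T i x) + P 1 (T i (P 1 (shiftSum T j x))) := by
    rw [H.shiftSum_add, map_add, H.shift_proj, H.proj_proj, min_eq_left (by omega)]
  have n1 : ‖P 1 (shiftSum T (i + j) x)‖ ≤ ‖P 1 (shiftSum T i x)‖ + ‖P 1 (shiftSum T j x)‖ := by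
    rw [e1]
    refine (norm_add_le _ _).trans (add_le_add le_rfl ?_)
    exact (H.norm_proj_le _ _).trans (H.norm_shift _ _).le
  set a := shiftSum T i x - P i (shiftSum T i x) with ha
  set b := shiftSum T j x - P j (shiftSum T j x) with hb
  have e2 : shiftSum T (i + j) x - P (i + j : ℕ) (shiftSum T (i + j) x)
      = (a - P (i + j : ℕ) a) + T i b := by
    rw [H.shiftSum_add, map_add, ha, hb, map_sub, map_sub, H.proj_proj, H.shift_proj,
      min_eq_right (by push_cast; omega)]
    rw [show ((i + j : ℕ) : ℤ) = (j : ℤ) + i by push_cast; ring]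
    abel
  have n2 : ‖shiftSum T (i + j) x - P (i + j : ℕ) (shiftSum T (i + j) x)‖ ≤ 2 * ‖a‖ + ‖b‖ := by
    rw [e2]
    refine (norm_add_le _ _).trans (add_le_add ?_ (H.norm_shift _ _).le)
    refine (norm_sub_le _ _).trans ?_
    linarith [H.norm_proj_le (i + j : ℕ) a]
  unfold projNorm
  rw [← ha, ← hb]
  linarith [norm_nonneg (P 1 (shiftSum T i x)), norm_nonneg (P 1 (shiftSum T j x)), norm_nonneg b]

/-- Averaging the near subadditivity over the splittings of `n` as `k + (n - k)` bounds a single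
term by the mean of all earlier ones. -/
lemma mul_projNorm_le (n : ℕ) (x : X) :
    n * projNorm P T n x ≤ 4 * ∑ k ∈ Icc 1 n, projNorm P T k x := by
  rcases n with _ | n
  · simp
  have h1 : ∀ k ∈ Icc 1 n, projNorm P T (n + 1) x
      ≤ 2 * (projNorm P T k x + projNorm P T (n + 1 - k) x) := by
    intro k hk
    rw [mem_Icc] at hk
    have := H.projNorm_add_le k (n + 1 - k) x
    rwa [show k + (n + 1 - k) = n + 1 by omega] at this
  have h2 := Finset.sum_le_sum h1
  rw [Finset.sum_const, Nat.card_Icc, nsmul_eq_mul, ← Finset.mul_sum, Finset.sum_add_distrib] at h2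
  have h3 : ∑ k ∈ Icc 1 n, projNorm P T (n + 1 - k) x = ∑ k ∈ Icc 1 n, projNorm P T k x := by
    refine Finset.sum_nbij' (fun k => n + 1 - k) (fun k => n + 1 - k) ?_ ?_ ?_ ?_ ?_ <;>
      intro k hk <;> simp only [mem_Icc] at hk ⊢ <;> omega
  rw [h3] at h2
  rw [Finset.sum_Icc_succ_top (by omega)]
  have := projNorm_nonneg (P := P) (T := T) (n + 1) x
  push_cast at h2 ⊢
  linarith

/-- Merging raises the level of the first half from `h` to `2h` and lowers the past of the second
half from `h` to `0`; `mergeDiff` records these two changes. -/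
lemma blockDiff_add (h : ℕ) (x : X) :
    blockDiff P T (h + h) x
      = blockDiff P T h x + T h (blockDiff P T h x) + mergeDiff P T h x := by
  unfold blockDiff mergeDiff
  simp only [H.shiftSum_add, map_add, map_sub, H.shift_proj]
  push_cast
  simp only [zero_add]
  abel

lemma norm_mergeDiff_le (h : ℕ) (x : X) : ‖mergeDiff P T h x‖ ≤ 2 * projNorm P T h x := by
  have e1 : P (h + h : ℕ) (shiftSum T h x) - P h (shiftSum T h x)
      = P (h + h : ℕ) (shiftSum T h x - P h (shiftSum T h x)) := by
    rw [map_sub, H.proj_proj, min_eq_right (by push_cast; omega)]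
  -- `P_h T_h = T_h P_0`, and `P_0 = P_0 P_1` brings in the level 1 used by `projNorm`.
  have e2 : P h (T h (shiftSum T h x)) = T h (P 0 (P 1 (shiftSum T h x))) := by
    rw [H.proj_proj, H.shift_proj]; simp
  have e3 : P 0 (T h (shiftSum T h x)) = T h (P (-h) (P 1 (shiftSum T h x))) := by
    rw [H.proj_proj, H.shift_proj, min_eq_left (by omega)]; simp
  unfold mergeDiff projNorm
  rw [e1, e2, e3]
  refine (norm_add_le _ _).trans ?_
  have n1 := H.norm_proj_le (h + h : ℕ) (shiftSum T h x - P h (shiftSum T h x))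
  have n2 := norm_sub_le (T h (P 0 (P 1 (shiftSum T h x)))) (T h (P (-h) (P 1 (shiftSum T h x))))
  rw [H.norm_shift, H.norm_shift] at n2
  have n3 := H.norm_proj_le 0 (P 1 (shiftSum T h x))
  have n4 := H.norm_proj_le (-h) (P 1 (shiftSum T h x))
  have n5 := norm_nonneg (shiftSum T h x - P h (shiftSum T h x))
  linarith

lemma norm_blockDiff_one_le (x : X) : ‖blockDiff P T 1 x‖ ≤ 2 * projNorm P T 1 x := by
  have e : P 0 (shiftSum T 1 x) = P 0 (P 1 (shiftSum T 1 x)) := by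
    rw [H.proj_proj]; simp
  unfold blockDiff projNorm
  rw [e]
  refine (norm_sub_le _ _).trans ?_
  have := H.norm_proj_le 0 (P 1 (shiftSum T 1 x))
  have n5 := norm_nonneg (shiftSum T 1 x - P (1 : ℕ) (shiftSum T 1 x))
  push_cast at *
  linarith

/-- Sums of stationary martingale differences are of the order of the square root of the number of
terms. -/
lemma norm_sum_shift_le (L N : ℕ) {y : X} (hL : P L y = y) (h0 : P 0 y = 0) :
    ‖∑ b ∈ range N, T (b * L) y‖ ^ 2 ≤ K * N * ‖y‖ ^ 2
      ∧ P (N * L : ℕ) (∑ b ∈ range N, T (b * L) y) = ∑ b ∈ range N, T (b * L) y := by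
  induction N with
  | zero => simp
  | succ N ih =>
    rw [Finset.sum_range_succ]
    refine ⟨?_, ?_⟩
    -- The partial sum is fixed by `P_{NL}` and the new term is killed by it, so smoothness adds at
    -- most `K ‖y‖²`.
    · have hy : P (N * L : ℕ) (T (N * L) y) = 0 := by
        have := H.shift_proj (N * L) 0 y
        rw [h0, map_zero, zero_add] at this
        exact this.symm
      have := H.smooth _ _ _ ih.2 hy
      rw [H.norm_shift] at this
      push_cast
      nlinarith [ih.1]
    · rw [map_add]
      congr 1
      · exact H.proj_eq_of_le (by push_cast; nlinarith) ih.2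
      · have := H.shift_proj (N * L) L y
        rw [hL] at this
        rw [this]
        rw [show (L : ℤ) + (N * L : ℕ) = ((N + 1) * L : ℕ) by push_cast; ring, H.proj_proj, min_self]

lemma norm_sum_shift_le' (L N : ℕ) {y : X} (hL : P L y = y) (h0 : P 0 y = 0) :
    ‖∑ b ∈ range N, T (b * L) y‖ ≤ √K * √N * ‖y‖ := by
  have h := (H.norm_sum_shift_le L N hL h0).1
  have hK := H.one_le
  rw [← Real.sqrt_mul (by linarith)]
  refine (Real.le_sqrt (norm_nonneg _) (by positivity)).2 h |>.trans ?_
  rw [Real.sqrt_mul (by positivity), Real.sqrt_sq (norm_nonneg _)]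

lemma sum_shift_double (L N : ℕ) (y : X) :
    ∑ b ∈ range (N + N), T (b * L) y
      = ∑ b ∈ range N, T (b * L) y + T (N * L) (∑ b ∈ range N, T (b * L) y) := by
  rw [Finset.sum_range_add, map_sum]
  congr 1
  refine Finset.sum_congr rfl fun b _ => ?_
  rw [← H.shift_add, add_mul]

/-- At scale `s` there remain `2^(r-1-s)` translates of one correction, on consecutive blocks of
length `2^(s+1)`, hence a sum of martingale differences. -/
lemma blockDiff_two_pow (r : ℕ) (x : X) :
    blockDiff P T (2 ^ r) x = ∑ b ∈ range (2 ^ r), T (b * 1) (blockDiff P T 1 x)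
      + ∑ s ∈ range r, ∑ b ∈ range (2 ^ (r - 1 - s)),
          T (b * 2 ^ (s + 1)) (mergeDiff P T (2 ^ s) x) := by
  induction r with
  | zero => simp [H.shift_zero]
  | succ r ih =>
    rw [pow_succ, mul_two, H.blockDiff_add, H.sum_shift_double, Finset.sum_range_succ]
    have hs : ∀ s ∈ range r, ∑ b ∈ range (2 ^ (r + 1 - 1 - s)),
          T (b * 2 ^ (s + 1)) (mergeDiff P T (2 ^ s) x)
        = ∑ b ∈ range (2 ^ (r - 1 - s)), T (b * 2 ^ (s + 1)) (mergeDiff P T (2 ^ s) x)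
          + T (2 ^ r) (∑ b ∈ range (2 ^ (r - 1 - s)),
              T (b * 2 ^ (s + 1)) (mergeDiff P T (2 ^ s) x)) := by
      intro s hs
      rw [mem_range] at hs
      rw [show r + 1 - 1 - s = (r - 1 - s) + 1 by omega, pow_succ, mul_two, H.sum_shift_double,
        ← pow_add, show r - 1 - s + (s + 1) = r by omega]
    rw [Finset.sum_congr rfl hs, Finset.sum_add_distrib, ← map_sum, ih, map_add]
    simp [H.shift_zero]
    abel

lemma norm_blockDiff_two_pow_le (r : ℕ) (x : X) :
    ‖blockDiff P T (2 ^ r) x‖ ≤ √K * √2 ^ r * (2 * projNorm P T 1 x)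
      + ∑ s ∈ range r, √K * √2 ^ (r - 1 - s) * (2 * projNorm P T (2 ^ s) x) := by
  have sq : ∀ k : ℕ, √((2 ^ k : ℕ) : ℝ) = √2 ^ k := by
    intro k
    rw [Nat.cast_pow, Nat.cast_ofNat, Real.sqrt_eq_iff_mul_self_eq (by positivity) (by positivity),
      ← mul_pow, Real.mul_self_sqrt (by norm_num)]
  rw [H.blockDiff_two_pow]
  refine (norm_add_le _ _).trans (add_le_add ?_ ?_)
  · refine (H.norm_sum_shift_le' 1 (2 ^ r) ?_ ?_).trans ?_
    · unfold blockDiff; simp [H.proj_proj]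
    · unfold blockDiff; simp [H.proj_proj]
    · rw [sq]
      exact mul_le_mul_of_nonneg_left (H.norm_blockDiff_one_le x) (by positivity)
  · refine (norm_sum_le _ _).trans (Finset.sum_le_sum fun s _ => ?_)
    refine (H.norm_sum_shift_le' (2 ^ (s + 1)) _ ?_ ?_).trans ?_
    · unfold mergeDiff
      rw [pow_succ, mul_two]
      simp only [map_add, map_sub, H.proj_proj]
      push_cast
      rw [min_eq_right (show ((2:ℤ) ^ s) ≤ 2 ^ s + 2 ^ s by simp),
        min_eq_right (show (0:ℤ) ≤ 2 ^ s + 2 ^ s by positivity), min_self]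
    · unfold mergeDiff
      simp only [map_add, map_sub, H.proj_proj]
      push_cast
      rw [min_eq_left (show (0:ℤ) ≤ 2 ^ s by positivity),
        min_eq_left (show (0:ℤ) ≤ 2 ^ s + 2 ^ s by positivity), min_self]
      simp
    · rw [sq]
      exact mul_le_mul_of_nonneg_left (H.norm_mergeDiff_le _ x) (by positivity)

lemma norm_shiftSum_two_pow_le (r : ℕ) (x : X) :
    ‖shiftSum T (2 ^ r) x‖
      ≤ 5 * √K * √2 ^ r * ∑ s ∈ range (r + 1), projNorm P T (2 ^ s) x / √2 ^ s := by
  have hK : 1 ≤ √K := Real.one_le_sqrt.2 H.one_le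
  have h2 : 1 ≤ √2 := Real.one_le_sqrt.2 (by norm_num)
  have w0 : ∀ k, 0 ≤ projNorm P T k x := fun k => projNorm_nonneg k x
  set G := ∑ s ∈ range (r + 1), projNorm P T (2 ^ s) x / √2 ^ s with hG
  have a1 : projNorm P T 1 x ≤ G := by
    have := Finset.single_le_sum (f := fun s => projNorm P T (2 ^ s) x / √2 ^ s)
      (fun s _ => div_nonneg (w0 _) (by positivity)) (mem_range.2 (Nat.succ_pos r))
    simpa using this
  have a2 : ∑ s ∈ range r, √K * √2 ^ (r - 1 - s) * (2 * projNorm P T (2 ^ s) x)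
      + projNorm P T (2 ^ r) x ≤ √K * √2 ^ r * (2 * G) := by
    rw [hG, Finset.sum_range_succ, mul_add 2, mul_add, Finset.mul_sum, Finset.mul_sum]
    refine add_le_add (Finset.sum_le_sum fun s hs => ?_) ?_
    · rw [mem_range] at hs
      have : √2 ^ r = √2 ^ (r - 1 - s) * √2 * √2 ^ s := by
        rw [← pow_succ, ← pow_add]; congr 1; omega
      rw [this]
      have hs0 : √2 ^ s ≠ 0 := by positivity
      rw [show √K * (√2 ^ (r - 1 - s) * √2 * √2 ^ s) * (2 * (projNorm P T (2 ^ s) x / √2 ^ s))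
        = √2 * (√K * √2 ^ (r - 1 - s) * (2 * projNorm P T (2 ^ s) x)) by field_simp]
      exact le_mul_of_one_le_left (by have := w0 (2 ^ s); positivity) h2
    · have : √K * √2 ^ r * (2 * (projNorm P T (2 ^ r) x / √2 ^ r))
        = √K * (2 * projNorm P T (2 ^ r) x) := by field_simp
      rw [this]
      nlinarith [w0 (2 ^ r)]
  have e : shiftSum T (2 ^ r) x = blockDiff P T (2 ^ r) x
      + (P 0 (P 1 (shiftSum T (2 ^ r) x))
        + (shiftSum T (2 ^ r) x - P (2 ^ r : ℕ) (shiftSum T (2 ^ r) x))) := by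
    unfold blockDiff
    rw [H.proj_proj, min_eq_left (by norm_num)]
    abel
  have b1 := H.norm_blockDiff_two_pow_le r x
  have b2 : ‖P 0 (P 1 (shiftSum T (2 ^ r) x))
        + (shiftSum T (2 ^ r) x - P (2 ^ r : ℕ) (shiftSum T (2 ^ r) x))‖
      ≤ projNorm P T (2 ^ r) x := by
    unfold projNorm
    exact (norm_add_le _ _).trans (add_le_add (H.norm_proj_le _ _) le_rfl)
  have b3 := norm_add_le (blockDiff P T (2 ^ r) x) (P 0 (P 1 (shiftSum T (2 ^ r) x))
        + (shiftSum T (2 ^ r) x - P (2 ^ r : ℕ) (shiftSum T (2 ^ r) x)))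
  rw [← e] at b3
  have b4 : √K * √2 ^ r * (2 * projNorm P T 1 x) ≤ √K * √2 ^ r * (2 * G) := by gcongr
  have hG0 : 0 ≤ √K * √2 ^ r * G := by
    have := (w0 1).trans a1; positivity
  linarith

lemma norm_shiftSum_lt_two_pow_le (r n : ℕ) (hn : n < 2 ^ (r + 1)) (x : X) :
    ‖shiftSum T n x‖
      ≤ 20 * √K * √2 ^ r * ∑ s ∈ range (r + 1), projNorm P T (2 ^ s) x / √2 ^ s := by
  have hK : 1 ≤ √K := Real.one_le_sqrt.2 H.one_le
  have h2 : 1 ≤ √2 := Real.one_le_sqrt.2 (by norm_num)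
  have w0 : ∀ s, 0 ≤ projNorm P T (2 ^ s) x / √2 ^ s := fun s =>
    div_nonneg (projNorm_nonneg _ x) (by positivity)
  induction r generalizing n with
  | zero =>
    rcases (by omega : n = 0 ∨ n = 2 ^ 0) with rfl | rfl
    · have := projNorm_nonneg (P := P) (T := T) 1 x
      simp [shiftSum]; positivity
    · refine (H.norm_shiftSum_two_pow_le 0 x).trans ?_
      have := Finset.sum_nonneg fun s (_ : s ∈ range (0 + 1)) => w0 s
      gcongr; norm_num
  | succ r ih =>
    set G := ∑ s ∈ range (r + 1), projNorm P T (2 ^ s) x / √2 ^ s with hG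
    set G' := ∑ s ∈ range (r + 1 + 1), projNorm P T (2 ^ s) x / √2 ^ s with hG'
    have hG0 : 0 ≤ G := Finset.sum_nonneg fun s _ => w0 s
    have hGG : G ≤ G' := by
      rw [hG', Finset.sum_range_succ]; linarith [w0 (r + 1)]
    have key : ∀ k < 2 ^ (r + 1), ‖shiftSum T k x‖ ≤ 15 * √K * √2 ^ (r + 1) * G' := by
      intro k hk
      refine (ih k hk).trans ?_
      rw [pow_succ]
      -- Removing the leading binary digit closes the induction because `20 / √2 ≤ 15` and `5 + 15 =
      -- 20`.
      have h43 : 4 / 3 ≤ √2 := Real.le_sqrt_of_sq_le (by norm_num)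
      calc 20 * √K * √2 ^ r * G = 15 * √K * (√2 ^ r * (4 / 3)) * G := by ring
        _ ≤ 15 * √K * (√2 ^ r * √2) * G' := by gcongr
    have hpos : 0 ≤ √K * √2 ^ (r + 1) * G' := by have := hG0.trans hGG; positivity
    by_cases h : n < 2 ^ (r + 1)
    · linarith [key n h]
    · push Not at h
      obtain ⟨k, rfl⟩ := Nat.exists_eq_add_of_le h
      have hk : k < 2 ^ (r + 1) := by rw [pow_succ 2 (r + 1)] at hn; omega
      rw [H.shiftSum_add]
      have c1 := norm_add_le (shiftSum T (2 ^ (r + 1)) x) (T (2 ^ (r + 1)) (shiftSum T k x))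
      rw [H.norm_shift] at c1
      linarith [key k hk, H.norm_shiftSum_two_pow_le (r + 1) x]

/-- A Peligrad–Utev type inequality, not requiring adaptedness. -/
theorem norm_shiftSum_le (n : ℕ) (x : X) :
    ‖shiftSum T n x‖ ≤ 160 * √K * √n * ∑ k ∈ Icc 1 n, projNorm P T k x / (k : ℝ) ^ (3 / 2 : ℝ) := by
  rcases Nat.eq_zero_or_pos n with rfl | hn
  · simp [shiftSum]
  have w0 : ∀ k, 0 ≤ projNorm P T k x := fun k => projNorm_nonneg k x
  have hr : 2 ^ Nat.log 2 n ≤ n := Nat.pow_log_le_self 2 hn.ne'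
  set r := Nat.log 2 n
  -- Replacing `w_{2^s}` by a mean over `k ≤ 2^s` divides by a further `2^s`, so the weight becomes
  -- `2^{-3s/2}`.
  have h1 : ∑ s ∈ range (r + 1), projNorm P T (2 ^ s) x / √2 ^ s
      ≤ 4 * ∑ s ∈ range (r + 1), (∑ k ∈ Icc 1 (2 ^ s), projNorm P T k x) / (√2 ^ 3) ^ s := by
    rw [Finset.mul_sum]
    refine Finset.sum_le_sum fun s _ => ?_
    have := H.mul_projNorm_le (2 ^ s) x
    have e : (√2 ^ 3) ^ s = 2 ^ s * √2 ^ s := by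
      rw [← mul_pow, pow_succ, Real.sq_sqrt (by norm_num)]
    rw [e, mul_div_assoc', div_le_div_iff₀ (by positivity) (by positivity)]
    push_cast at this
    have h2 : 0 ≤ √2 ^ s := by positivity
    nlinarith
  have h2 := sum_dyadic_le w0 r
  have h3 : ∑ k ∈ Icc 1 (2 ^ r), projNorm P T k x / (k : ℝ) ^ (3 / 2 : ℝ)
      ≤ ∑ k ∈ Icc 1 n, projNorm P T k x / (k : ℝ) ^ (3 / 2 : ℝ) :=
    Finset.sum_le_sum_of_subset_of_nonneg (Finset.Icc_subset_Icc le_rfl hr)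
      fun k _ _ => div_nonneg (w0 k) (by positivity)
  have h4 : √2 ^ r ≤ √n := by
    refine Real.le_sqrt_of_sq_le ?_
    rw [← pow_mul, mul_comm r 2, pow_mul, Real.sq_sqrt (by norm_num)]
    exact_mod_cast hr
  have h5 := H.norm_shiftSum_lt_two_pow_le r n (Nat.lt_pow_succ_log_self (by norm_num) n) x
  have h6 : ∑ s ∈ range (r + 1), projNorm P T (2 ^ s) x / √2 ^ s
      ≤ 8 * ∑ k ∈ Icc 1 n, projNorm P T k x / (k : ℝ) ^ (3 / 2 : ℝ) := by linarith
  have h7 : 0 ≤ ∑ k ∈ Icc 1 n, projNorm P T k x / (k : ℝ) ^ (3 / 2 : ℝ) :=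
    Finset.sum_nonneg fun k _ => div_nonneg (w0 k) (by positivity)
  calc ‖shiftSum T n x‖
      ≤ 20 * √K * √2 ^ r * (8 * ∑ k ∈ Icc 1 n, projNorm P T k x / (k : ℝ) ^ (3 / 2 : ℝ)) :=
        h5.trans (by gcongr)
    _ ≤ 20 * √K * √n * (8 * ∑ k ∈ Icc 1 n, projNorm P T k x / (k : ℝ) ^ (3 / 2 : ℝ)) := by gcongr
    _ = _ := by ring

end IsSmoothSystem

/-- The two-parameter analogue of `projNorm`, for the partial sum `y` over a `k × l` rectangle. -/
noncomputable def rectProjNorm (P₁ P₂ : ℤ → X →+ X) (k l : ℕ) (y : X) : ℝ :=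
  ‖P₂ 1 (P₁ 1 y)‖ + ‖P₁ 1 y - P₂ l (P₁ 1 y)‖ + ‖P₂ 1 (y - P₁ k y)‖
    + ‖y - P₁ k y - P₂ l (y - P₁ k y)‖

lemma rectProjNorm_nonneg (P₁ P₂ : ℤ → X →+ X) (k l : ℕ) (y : X) :
    0 ≤ rectProjNorm P₁ P₂ k l y := by
  unfold rectProjNorm; positivity

/-- The two-parameter inequality, obtained by using the one-parameter one in each direction. -/
theorem norm_shiftSum_shiftSum_le {P₁ P₂ : ℤ → X →+ X} {T₁ T₂ : ℕ → X →+ X} {K : ℝ}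
    (H₁ : IsSmoothSystem P₁ T₁ K) (H₂ : IsSmoothSystem P₂ T₂ K)
    (hPT : ∀ (i : ℤ) (j : ℕ) x, P₁ i (T₂ j x) = T₂ j (P₁ i x))
    (hTT : ∀ (i j : ℕ) x, T₁ i (T₂ j x) = T₂ j (T₁ i x)) (m n : ℕ) (x : X) :
    ‖shiftSum T₁ m (shiftSum T₂ n x)‖ ≤ 160 * √K * (160 * √K) * √m * √n *
      ∑ k ∈ Icc 1 m, ∑ l ∈ Icc 1 n, rectProjNorm P₁ P₂ k l (shiftSum T₁ k (shiftSum T₂ l x))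
        / ((k : ℝ) ^ (3 / 2 : ℝ) * (l : ℝ) ^ (3 / 2 : ℝ)) := by
  have c1 : ∀ k n, shiftSum T₁ k (shiftSum T₂ n x) = shiftSum T₂ n (shiftSum T₁ k x) := by
    intro k n
    simp only [shiftSum, map_sum]
    rw [Finset.sum_comm]
    simp only [hTT]
  have c2 : ∀ i n y, P₁ i (shiftSum T₂ n y) = shiftSum T₂ n (P₁ i y) := by
    intro i n y
    simp only [shiftSum, map_sum, hPT]
  have c3 : ∀ n y z, shiftSum T₂ n y - shiftSum T₂ n z = shiftSum T₂ n (y - z) := by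
    intro n y z
    simp only [shiftSum, map_sub, Finset.sum_sub_distrib]
  -- For fixed `k`, both elements inside the horizontal `projNorm` are `T₂`-sums; the vertical
  -- inequality for each yields two norms, four in all.
  have key : ∀ k : ℕ, projNorm P₁ T₁ k (shiftSum T₂ n x) ≤ 160 * √K * √n *
      ∑ l ∈ Icc 1 n, rectProjNorm P₁ P₂ k l (shiftSum T₁ k (shiftSum T₂ l x))
        / (l : ℝ) ^ (3 / 2 : ℝ) := by
    intro k
    have h1 := H₂.norm_shiftSum_le n (P₁ 1 (shiftSum T₁ k x))
    have h2 := H₂.norm_shiftSum_le n (shiftSum T₁ k x - P₁ k (shiftSum T₁ k x))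
    rw [projNorm, c1, c2, c2, c3]
    refine (add_le_add h1 h2).trans (le_of_eq ?_)
    rw [← mul_add, ← Finset.sum_add_distrib]
    refine congr_arg _ (Finset.sum_congr rfl fun l _ => ?_)
    rw [← add_div, rectProjNorm, projNorm, projNorm, c1, c2, c2, c3]
    ring
  refine (H₁.norm_shiftSum_le m _).trans ?_
  refine (mul_le_mul_of_nonneg_left (Finset.sum_le_sum fun k _ =>
    div_le_div_of_nonneg_right (key k) (by positivity)) (by positivity)).trans (le_of_eq ?_)
  simp only [Finset.mul_sum, Finset.sum_div]
  refine Finset.sum_congr rfl fun k _ => Finset.sum_congr rfl fun l _ => ?_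
  rw [mul_comm ((k : ℝ) ^ (3 / 2 : ℝ)), ← div_div]
  ring

end Abstract
/-! ### 2-smoothness of `L^p` along martingale differences -/

section Smooth

/-- The tangent to `z ↦ z^q` taken at `z` rather than at 1: Bernoulli's inequality at `z⁻¹`,
multiplied by `z^q`. -/
lemma rpow_sub_one_le_mul {q z : ℝ} (hq : 1 ≤ q) (hz : 0 < z) :
    z ^ q - 1 ≤ q * (z - 1) * z ^ (q - 1) := by
  have h := one_add_mul_self_le_rpow_one_add (s := z⁻¹ - 1) (by linarith [inv_pos.2 hz]) hq
  rw [add_sub_cancel, Real.inv_rpow hz.le] at h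
  have hp : 0 < z ^ q := Real.rpow_pos_of_pos hz q
  have h2 := mul_le_mul_of_nonneg_right h hp.le
  rw [inv_mul_cancel₀ hp.ne'] at h2
  have e : z⁻¹ * z ^ q = z ^ (q - 1) := by
    rw [Real.rpow_sub_one hz.ne']; field_simp
  have e2 : z ^ q = z * z ^ (q - 1) := by
    rw [Real.rpow_sub_one hz.ne']; field_simp
  have : (1 + q * (z⁻¹ - 1)) * z ^ q = z ^ q + q * (z⁻¹ * z ^ q) - q * z ^ q := by ring
  rw [this, e] at h2
  have : q * (z - 1) * z ^ (q - 1) = q * (z * z ^ (q - 1)) - q * z ^ (q - 1) := by ring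
  rw [this, ← e2]
  linarith

lemma one_add_rpow_le {p t : ℝ} (hp : 2 ≤ p) (ht : |t| ≤ 1 / 2) :
    (1 + t) ^ p ≤ 1 + p * t + p * (p - 1) * 2 ^ p * t ^ 2 := by
  obtain ⟨h1, h2⟩ := abs_le.1 ht
  have hz : 0 < 1 + t := by linarith
  have a := rpow_sub_one_le_mul (q := p) (by linarith) hz
  have h2p : 1 ≤ (2 : ℝ) ^ p := Real.one_le_rpow (by norm_num) (by linarith)
  -- This is the second-order remainder: for `t ≥ 0` the tangent at `1 + t` bounds it, for `t ≤ 0`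
  -- the tangent at 1 (Bernoulli) does.
  have key : t * ((1 + t) ^ (p - 1) - 1) ≤ (p - 1) * 2 ^ p * t ^ 2 := by
    rcases le_total 0 t with h | h
    · have b := rpow_sub_one_le_mul (q := p - 1) (by linarith) hz
      have c : (1 + t) ^ (p - 1 - 1) ≤ 2 ^ p :=
        (Real.rpow_le_rpow hz.le (by linarith) (by linarith)).trans
          (Real.rpow_le_rpow_of_exponent_le one_le_two (by linarith))
      calc t * ((1 + t) ^ (p - 1) - 1) ≤ t * ((p - 1) * (1 + t - 1) * (1 + t) ^ (p - 1 - 1)) := by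
            gcongr
        _ ≤ t * ((p - 1) * (1 + t - 1) * 2 ^ p) := by
            rw [add_sub_cancel_left]
            have : 0 ≤ p - 1 := by linarith
            gcongr
        _ = _ := by ring
    · have b := one_add_mul_self_le_rpow_one_add (s := t) (by linarith) (p := p - 1) (by linarith)
      have : t * ((1 + t) ^ (p - 1) - 1) ≤ t * ((p - 1) * t) :=
        mul_le_mul_of_nonpos_left (by linarith) h
      have h3 : 0 ≤ (p - 1) * t ^ 2 := mul_nonneg (by linarith) (sq_nonneg t)
      nlinarith
  have := mul_le_mul_of_nonneg_left key (show 0 ≤ p by linarith)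
  rw [add_sub_cancel_left] at a
  linarith

lemma abs_add_rpow_le_of_pos {p x y : ℝ} (hp : 2 ≤ p) (hx : 0 < x) (hy : |y| ≤ x / 2) :
    |x + y| ^ p ≤ x ^ p + p * (x ^ (p - 2) * x) * y
      + p * (p - 1) * 2 ^ p * (x ^ (p - 2) * y ^ 2) := by
  have ht : |y / x| ≤ 1 / 2 := by
    rw [abs_div, abs_of_pos hx, div_le_iff₀ hx]; linarith
  have h := mul_le_mul_of_nonneg_left (one_add_rpow_le hp ht) (Real.rpow_nonneg hx.le p)
  have h1 := (abs_le.1 ht).1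
  rw [← Real.mul_rpow hx.le (by linarith), mul_add, mul_one, mul_div_cancel₀ _ hx.ne'] at h
  have h2 := (abs_le.1 hy).1
  rw [abs_of_nonneg (by linarith)]
  refine h.trans (le_of_eq ?_)
  have e : x ^ p = x ^ (p - 2) * x ^ 2 := by
    rw [← Real.rpow_natCast, ← Real.rpow_add hx]; norm_num
  rw [e]
  field_simp

lemma rpow_mul_rpow_le_add {p r a b : ℝ} (hr : 0 ≤ r) (hrp : r ≤ p) (ha : 0 ≤ a)
    (hb : 0 ≤ b) : a ^ (p - r) * b ^ r ≤ a ^ p + b ^ p := by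
  have key : ∀ c : ℝ, 0 ≤ c → a ≤ c → b ≤ c → a ^ (p - r) * b ^ r ≤ c ^ p := by
    intro c hc hac hbc
    calc a ^ (p - r) * b ^ r ≤ c ^ (p - r) * c ^ r := by
          gcongr
      _ = c ^ p := by
          rw [← Real.rpow_add_of_nonneg hc (by linarith) hr]; simp
  have h1 := Real.rpow_nonneg ha p
  have h2 := Real.rpow_nonneg hb p
  rcases le_total a b with h | h
  · linarith [key b hb h le_rfl]
  · linarith [key a ha le_rfl h]

/-- Where `|y| ≤ |x| / 2` this is a Taylor expansion; where `|x| ≤ 2|y|` every term is dominated by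
`|y|^p`. -/
lemma exists_abs_add_rpow_le {p : ℝ} (hp : 2 ≤ p) : ∃ C : ℝ, 0 ≤ C ∧ ∀ x y : ℝ,
    |x + y| ^ p ≤ |x| ^ p + p * (|x| ^ (p - 2) * x) * y
      + C * (|x| ^ (p - 2) * y ^ 2 + |y| ^ p) := by
  have hp1 : 0 ≤ p * (p - 1) := mul_nonneg (by linarith) (by linarith)
  have h3 : (0 : ℝ) ≤ 3 ^ p := by positivity
  have h2 : (0 : ℝ) ≤ 2 ^ p := by positivity
  have hp0 : 0 ≤ p := by linarith
  refine ⟨3 ^ p + p * 2 ^ p + p * (p - 1) * 2 ^ p, by positivity, fun x y => ?_⟩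
  have n1 : 0 ≤ |x| ^ (p - 2) * y ^ 2 := by positivity
  have n2 : 0 ≤ |y| ^ p := by positivity
  by_cases h : |y| ≤ |x| / 2 ∧ x ≠ 0
  · obtain ⟨h, hx⟩ := h
    have key : |x + y| ^ p ≤ |x| ^ p + p * (|x| ^ (p - 2) * x) * y
        + p * (p - 1) * 2 ^ p * (|x| ^ (p - 2) * y ^ 2) := by
      rcases hx.lt_or_gt with hx | hx
      · have := abs_add_rpow_le_of_pos (x := -x) (y := -y) hp (by linarith)
          (by rwa [abs_neg, ← abs_of_neg hx])
        rw [← neg_add, abs_neg] at this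
        rw [abs_of_neg hx]
        refine this.trans (le_of_eq ?_)
        ring
      · have := abs_add_rpow_le_of_pos (x := x) (y := y) hp hx (by rwa [← abs_of_pos hx])
        rwa [abs_of_pos hx]
    refine key.trans ?_
    refine add_le_add le_rfl ?_
    refine mul_le_mul ?_ (le_add_of_nonneg_right n2) n1 (by positivity)
    have : 0 ≤ p * 2 ^ p := by positivity
    linarith
  · have hxy : |x| ≤ 2 * |y| := by
      by_cases hx : x = 0
      · simp [hx]
      · have : ¬ |y| ≤ |x| / 2 := fun h' => h ⟨h', hx⟩
        linarith
    have a1 : |x + y| ^ p ≤ 3 ^ p * |y| ^ p := by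
      rw [← Real.mul_rpow (by norm_num) (abs_nonneg _)]
      refine Real.rpow_le_rpow (abs_nonneg _) ?_ hp0
      linarith [abs_add_le x y]
    have a2 : - (|x| ^ (p - 2) * x * y) ≤ 2 ^ p * |y| ^ p := by
      calc - (|x| ^ (p - 2) * x * y) ≤ |(|x| ^ (p - 2) * x * y)| := neg_le_abs _
        _ = |x| ^ (p - 2) * |x| * |y| := by
            rw [abs_mul, abs_mul, abs_of_nonneg (Real.rpow_nonneg (abs_nonneg x) _)]
        _ ≤ (2 * |y|) ^ (p - 2) * (2 * |y|) * (2 * |y|) := by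
            gcongr
            linarith [abs_nonneg y]
        _ = (2 * |y|) ^ p := by
            rw [mul_assoc, ← pow_two, ← Real.rpow_natCast,
              ← Real.rpow_add_of_nonneg (by positivity) (by linarith) (by norm_num)]
            norm_num
        _ = _ := Real.mul_rpow (by norm_num) (abs_nonneg _)
    have a3 : p * -(|x| ^ (p - 2) * x * y) ≤ p * (2 ^ p * |y| ^ p) := by gcongr
    have a4 : 0 ≤ |x| ^ p := by positivity
    have a5 : 0 ≤ (3 ^ p + p * 2 ^ p + p * (p - 1) * 2 ^ p) * (|x| ^ (p - 2) * y ^ 2) := by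
      positivity
    have a6 : 0 ≤ p * (p - 1) * 2 ^ p * |y| ^ p := by positivity
    nlinarith

/-- The average of two lower bounds: superadditivity of `t ↦ t^(p/2)` gives the `b^p` term,
Bernoulli the `a^(p-2) b^2` term. -/
lemma rpow_add_le_rpow_sq_add {p K a b : ℝ} (hp : 2 ≤ p) (hK : 1 ≤ K) (ha : 0 < a) (hb : 0 ≤ b) :
    a ^ p + K / 2 * (a ^ (p - 2) * b ^ 2 + b ^ p) ≤ (a ^ 2 + K * b ^ 2) ^ (p / 2) := by
  have sqp : ∀ c : ℝ, 0 ≤ c → (c ^ 2) ^ (p / 2) = c ^ p := by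
    intro c hc
    rw [← Real.rpow_natCast, ← Real.rpow_mul hc]
    congr 1; push_cast; ring
  have h1 : a ^ p + K * b ^ p ≤ (a ^ 2 + K * b ^ 2) ^ (p / 2) := by
    refine le_trans ?_ (Real.add_rpow_le_rpow_add (by positivity) (by positivity) (by linarith))
    rw [Real.mul_rpow (by linarith) (by positivity), sqp a ha.le, sqp b hb]
    gcongr
    exact Real.self_le_rpow_of_one_le hK (by linarith)
  have h2 : a ^ p + K * (a ^ (p - 2) * b ^ 2) ≤ (a ^ 2 + K * b ^ 2) ^ (p / 2) := by
    have e : a ^ 2 + K * b ^ 2 = a ^ 2 * (1 + K * (b / a) ^ 2) := by field_simp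
    have hs : 0 ≤ K * (b / a) ^ 2 := by positivity
    rw [e, Real.mul_rpow (by positivity) (by positivity), sqp a ha.le]
    have h := one_add_mul_self_le_rpow_one_add (s := K * (b / a) ^ 2) (by linarith)
      (p := p / 2) (by linarith)
    have ep : a ^ p = a ^ (p - 2) * a ^ 2 := by
      rw [← Real.rpow_natCast, ← Real.rpow_add ha]; norm_num
    calc a ^ p + K * (a ^ (p - 2) * b ^ 2) = a ^ p * (1 + K * (b / a) ^ 2) := by
          rw [ep]; field_simp
      _ ≤ a ^ p * (1 + K * (b / a) ^ 2) ^ (p / 2) := by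
          gcongr
          refine le_trans ?_ h
          nlinarith
  linarith

variable {Ω : Type*} {mΩ : MeasurableSpace Ω} {μ : Measure Ω} {p : ℝ}

lemma toReal_eLpNorm_rpow (hp : 2 ≤ p) {f : Ω → ℝ} (hf : MemLp f (ENNReal.ofReal p) μ) :
    (eLpNorm f (ENNReal.ofReal p) μ).toReal ^ p = ∫ ω, |f ω| ^ p ∂μ := by
  have hp0 : 0 < p := by linarith
  have hI : 0 ≤ ∫ ω, |f ω| ^ p ∂μ := integral_nonneg fun ω => by positivity
  rw [hf.eLpNorm_eq_integral_rpow_norm (by simpa using hp0) ENNReal.ofReal_ne_top,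
    ENNReal.toReal_ofReal hp0.le]
  simp only [Real.norm_eq_abs]
  rw [ENNReal.toReal_ofReal (by positivity), ← Real.rpow_mul hI, inv_mul_cancel₀ hp0.ne',
    Real.rpow_one]

lemma integrable_abs_rpow (hp : 2 ≤ p) {f : Ω → ℝ} (hf : MemLp f (ENNReal.ofReal p) μ) :
    Integrable (fun ω => |f ω| ^ p) μ := by
  have := hf.integrable_norm_rpow (by simp; linarith) ENNReal.ofReal_ne_top
  simpa [ENNReal.toReal_ofReal (by linarith : 0 ≤ p)] using this

/-- For `p ≥ 2`, the `L^p`-norm is 2-smooth along martingale differences, with a constant depending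
only on `p`. -/
lemma exists_smooth_const (hp : 2 ≤ p) : ∃ K : ℝ, 1 ≤ K ∧
    ∀ {Ω : Type u} {m mΩ : MeasurableSpace Ω} {μ : Measure Ω}, IsProbabilityMeasure μ → m ≤ mΩ →
      ∀ {X Y : Ω → ℝ}, MemLp X (ENNReal.ofReal p) μ → MemLp Y (ENNReal.ofReal p) μ →
        StronglyMeasurable[m] X → μ[Y | m] =ᵐ[μ] 0 →
        (eLpNorm (X + Y) (ENNReal.ofReal p) μ).toReal ^ 2
          ≤ (eLpNorm X (ENNReal.ofReal p) μ).toReal ^ 2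
            + K * (eLpNorm Y (ENNReal.ofReal p) μ).toReal ^ 2 := by
  obtain ⟨C, hC, hxy⟩ := exists_abs_add_rpow_le hp
  -- Integration will produce the coefficient `2C`, and `rpow_add_le_rpow_sq_add` absorbs
  -- coefficients up to `K / 2`.
  refine ⟨4 * C + 1, by linarith, ?_⟩
  intro Ω m mΩ μ _ hm X Y hX hY hXm hYm
  have hp0 : 0 < p := by linarith
  have hp1 : (1 : ℝ≥0∞) ≤ ENNReal.ofReal p := by
    rw [← ENNReal.ofReal_one]; exact ENNReal.ofReal_le_ofReal (by linarith)
  have hXY := hX.add hY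
  have eX := toReal_eLpNorm_rpow hp hX
  have eY := toReal_eLpNorm_rpow hp hY
  have eXY := toReal_eLpNorm_rpow hp hXY
  have tri : (eLpNorm (X + Y) (ENNReal.ofReal p) μ).toReal
      ≤ (eLpNorm X (ENNReal.ofReal p) μ).toReal + (eLpNorm Y (ENNReal.ofReal p) μ).toReal := by
    rw [← ENNReal.toReal_add hX.eLpNorm_ne_top hY.eLpNorm_ne_top]
    exact ENNReal.toReal_mono (by simp [hX.eLpNorm_ne_top, hY.eLpNorm_ne_top])
      (eLpNorm_add_le hX.1 hY.1 hp1)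
  set a := (eLpNorm X (ENNReal.ofReal p) μ).toReal with ha
  set b := (eLpNorm Y (ENNReal.ofReal p) μ).toReal with hb
  set c := (eLpNorm (X + Y) (ENNReal.ofReal p) μ).toReal with hc
  have a0 : 0 ≤ a := ENNReal.toReal_nonneg
  have b0 : 0 ≤ b := ENNReal.toReal_nonneg
  have c0 : 0 ≤ c := ENNReal.toReal_nonneg
  -- If one norm vanishes the triangle inequality suffices; below, `X` and `Y` are divided by their
  -- norms.
  rcases a0.eq_or_lt with h | apos
  · rw [← h] at tri ⊢; nlinarith
  rcases b0.eq_or_lt with h | bpos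
  · rw [← h] at tri ⊢; nlinarith
  have iX := integrable_abs_rpow hp hX
  have iY := integrable_abs_rpow hp hY
  have iXY := integrable_abs_rpow hp hXY
  -- the linear term is centred
  have hφm : StronglyMeasurable[m] (fun ω => |X ω| ^ (p - 2) * X ω) := by
    have h1 : Measurable[m] X := hXm.measurable
    exact (Measurable.mul ((measurable_abs.comp h1).pow_const _) h1).stronglyMeasurable
  have iφ : Integrable ((fun ω => |X ω| ^ (p - 2) * X ω) * Y) μ := by
    refine (iX.add iY).mono' ((hφm.mono hm).aestronglyMeasurable.mul hY.1) ?_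
    refine Filter.Eventually.of_forall fun ω => ?_
    have := rpow_mul_rpow_le_add (p := p) (r := 1) (by norm_num) (by linarith)
      (abs_nonneg (X ω)) (abs_nonneg (Y ω))
    simp only [Pi.mul_apply, Pi.add_apply, norm_mul, Real.norm_eq_abs]
    rw [abs_of_nonneg (Real.rpow_nonneg (abs_nonneg (X ω)) _)]
    rw [Real.rpow_one] at this
    refine le_trans (le_of_eq ?_) this
    congr 1
    rw [show p - 1 = p - 2 + 1 by ring,
      Real.rpow_add_of_nonneg (abs_nonneg _) (by linarith) (by norm_num), Real.rpow_one]
  have zφ : ∫ ω, (|X ω| ^ (p - 2) * X ω) * Y ω ∂μ = 0 := by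
    have h1 := condExp_mul_of_stronglyMeasurable_left hφm iφ (hY.integrable hp1)
    have h2 := integral_condExp hm (μ := μ) (f := (fun ω => |X ω| ^ (p - 2) * X ω) * Y)
    rw [integral_congr_ae h1] at h2
    have h3 : ∫ ω, ((fun ω => |X ω| ^ (p - 2) * X ω) * μ[Y | m]) ω ∂μ = 0 := by
      rw [integral_congr_ae (g := fun _ => (0 : ℝ)), integral_zero]
      filter_upwards [hYm] with ω hω
      simp [hω]
    rw [h3] at h2
    exact h2.symm
  -- the quadratic term
  have qpt : ∀ ω, |X ω| ^ (p - 2) * Y ω ^ 2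
      ≤ a ^ (p - 2) * b ^ 2 * (|X ω| ^ p / a ^ p + |Y ω| ^ p / b ^ p) := by
    intro ω
    -- After normalisation both `p`-th moments are 1, so this crude Young bound integrates to
    -- Hölder's inequality up to the factor 2.
    have := rpow_mul_rpow_le_add (p := p) (r := 2) (by norm_num) hp
      (a := |X ω| / a) (b := |Y ω| / b) (by positivity) (by positivity)
    rw [Real.div_rpow (abs_nonneg _) a0, Real.div_rpow (abs_nonneg _) b0,
      Real.div_rpow (abs_nonneg _) a0, Real.div_rpow (abs_nonneg _) b0, Real.rpow_two,
      Real.rpow_two, sq_abs] at this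
    refine le_trans (le_of_eq ?_) (mul_le_mul_of_nonneg_left this
      (show 0 ≤ a ^ (p - 2) * b ^ 2 by positivity))
    have : 0 < a ^ (p - 2) := by positivity
    field_simp
  have iq' : Integrable (fun ω => a ^ (p - 2) * b ^ 2 * (|X ω| ^ p / a ^ p + |Y ω| ^ p / b ^ p)) μ :=
    ((iX.div_const _).add (iY.div_const _)).const_mul _
  have iq : Integrable (fun ω => |X ω| ^ (p - 2) * Y ω ^ 2) μ := by
    refine iq'.mono' ?_ (Filter.Eventually.of_forall fun ω => ?_)
    · exact ((hX.1.aemeasurable.abs.pow_const _).mul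
        (hY.1.aemeasurable.pow_const _)).aestronglyMeasurable
    · rw [Real.norm_of_nonneg (by positivity)]; exact qpt ω
  have bq : ∫ ω, |X ω| ^ (p - 2) * Y ω ^ 2 ∂μ ≤ 2 * (a ^ (p - 2) * b ^ 2) := by
    refine (integral_mono iq iq' qpt).trans (le_of_eq ?_)
    rw [integral_const_mul, integral_add (iX.div_const _) (iY.div_const _), integral_div,
      integral_div, ← eX, ← eY, div_self (by positivity), div_self (by positivity)]
    ring
  have main : c ^ p ≤ a ^ p + C * (2 * (a ^ (p - 2) * b ^ 2) + b ^ p) := by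
    have i1 : Integrable (fun ω => p * (|X ω| ^ (p - 2) * X ω) * Y ω) μ := by
      have := iφ.const_mul p
      refine this.congr (Filter.Eventually.of_forall fun ω => ?_)
      simp [mul_assoc]
    have i2 : Integrable (fun ω => C * (|X ω| ^ (p - 2) * Y ω ^ 2 + |Y ω| ^ p)) μ :=
      (iq.add iY).const_mul C
    have h := integral_mono iXY ((iX.add i1).add i2) fun ω => hxy (X ω) (Y ω)
    rw [integral_add' (iX.add i1) i2, integral_add' iX i1, integral_const_mul, integral_add iq iY,
      ← eX, ← eY] at h
    have z : ∫ ω, p * (|X ω| ^ (p - 2) * X ω) * Y ω ∂μ = 0 := by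
      simp only [mul_assoc]
      rw [integral_const_mul]
      simp only [← mul_assoc]
      rw [zφ, mul_zero]
    rw [z] at h
    rw [eXY]
    refine h.trans ?_
    rw [add_zero]
    gcongr
  have fin := rpow_add_le_rpow_sq_add (K := 4 * C + 1) hp (by linarith) apos b0
  have h5 : c ^ p ≤ (a ^ 2 + (4 * C + 1) * b ^ 2) ^ (p / 2) := by
    refine main.trans (le_trans ?_ fin)
    have n1 : 0 ≤ a ^ (p - 2) * b ^ 2 := by positivity
    have n2 : 0 ≤ b ^ p := by positivity
    nlinarith
  have h6 : c ^ p = (c ^ 2) ^ (p / 2) := by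
    rw [← Real.rpow_natCast, ← Real.rpow_mul c0]
    congr 1; push_cast; ring
  rw [h6] at h5
  exact (Real.rpow_le_rpow_iff (by positivity) (by positivity) (by linarith)).1 h5

end Smooth
/-! ### Conditional expectations, shifts and commuting filtrations -/

section Operators

variable {Ω : Type*} {mΩ : MeasurableSpace Ω} {μ : Measure Ω}

lemma condExp_comp_measurePreserving {Ω : Type*} {m mΩ : MeasurableSpace Ω} {μ : Measure Ω}
    [IsFiniteMeasure μ] {τ : Ω → Ω} (hτe : MeasurableEmbedding τ) (hτ : MeasurePreserving τ μ μ)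
    (hm : m ≤ mΩ) {f : Ω → ℝ} (hf : Integrable f μ) :
    μ[f ∘ τ | m.comap τ] =ᵐ[μ] μ[f | m] ∘ τ := by
  have hm' : m.comap τ ≤ mΩ := by
    rintro _ ⟨t, ht, rfl⟩
    exact hτ.measurable (hm t ht)
  symm
  refine ae_eq_condExp_of_forall_setIntegral_eq hm' (hτ.integrable_comp_of_integrable hf) ?_ ?_ ?_
  · intro s _ _
    exact (hτ.integrable_comp_of_integrable integrable_condExp).integrableOn
  · rintro _ ⟨t, ht, rfl⟩ _
    have h1 := hτ.setIntegral_preimage_emb hτe (μ[f | m]) t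
    have h2 := hτ.setIntegral_preimage_emb hτe f t
    simp only [Function.comp_apply]
    rw [h1, h2, setIntegral_condExp hm hf ht]
  · exact (stronglyMeasurable_condExp.comp_measurable
      (comap_measurable τ)).aestronglyMeasurable

lemma integral_mul_condExp_comm [IsFiniteMeasure μ] {m : MeasurableSpace Ω} (hm : m ≤ mΩ)
    {f g : Ω → ℝ} (hf : Integrable f μ) (hg : Integrable g μ) {M : ℝ} (hgM : ∀ᵐ ω ∂μ, ‖g ω‖ ≤ M) :
    ∫ ω, g ω * (μ[f | m]) ω ∂μ = ∫ ω, (μ[g | m]) ω * f ω ∂μ := by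
  have hgM' : ∀ᵐ ω ∂μ, ‖(μ[g | m]) ω‖ ≤ M := by
    have hM : 0 ≤ M ∨ μ = 0 := by
      by_cases h : μ = 0
      · exact Or.inr h
      · have : NeZero μ := ⟨h⟩
        obtain ⟨ω, hω⟩ := hgM.exists
        exact Or.inl ((norm_nonneg _).trans hω)
    rcases hM with hM | hM
    · simpa using ae_bdd_abs_condExp_of_ae_bdd_abs (m := m) (R := M) (by simpa using hgM)
    · simp [hM]
  have i1 : Integrable (g * μ[f | m]) μ := integrable_condExp.bdd_mul hg.1 hgM
  have i2 : Integrable (μ[g | m] * f) μ := hf.bdd_mul integrable_condExp.1 hgM'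
  have h1 := condExp_mul_of_stronglyMeasurable_right stronglyMeasurable_condExp i1 hg
  have h2 := condExp_mul_of_stronglyMeasurable_left stronglyMeasurable_condExp i2 hf
  have e1 := integral_condExp hm (μ := μ) (f := g * μ[f | m])
  have e2 := integral_condExp hm (μ := μ) (f := μ[g | m] * f)
  rw [integral_congr_ae h1] at e1
  rw [integral_congr_ae h2] at e2
  exact e1.symm.trans e2

/-- Lévy's upward theorem for a constant sequence of conditional expectations. -/
lemma condExp_iSup_of_forall_eq [IsFiniteMeasure μ] (𝒢 : Filtration ℕ mΩ) {f g : Ω → ℝ}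
    (h : ∀ n, μ[f | 𝒢 n] =ᵐ[μ] g) : μ[f | ⨆ n, 𝒢 n] =ᵐ[μ] g := by
  filter_upwards [tendsto_ae_condExp (ℱ := 𝒢) (μ := μ) f, ae_all_iff.2 h] with ω h1 h2
  refine tendsto_nhds_unique h1 ?_
  simp only [h2]
  exact tendsto_const_nhds

section Filtration

variable (ℱ : Filtration (ℤ × ℤ) mΩ)

/-- The free starting index `j` serves both Lévy's theorem along `ℱ (i, j + n)` and invariance under
vertical shifts. -/
lemma sigmaTop₂_eq_iSup (i j : ℤ) : sigmaTop₂ ℱ i = ⨆ n : ℕ, ℱ (i, j + n) := by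
  refine le_antisymm (iSup₂_le fun l _ => ?_) (iSup_le fun n => ?_)
  · refine le_trans (ℱ.mono ?_) (le_iSup (fun n : ℕ => ℱ (i, j + n)) (l - j).toNat)
    exact Prod.mk_le_mk.2 ⟨le_rfl, by omega⟩
  · refine le_trans (ℱ.mono (?_ : (i, j + (n : ℤ)) ≤ (i, max 0 (j + n))))
      (le_iSup₂_of_le (max 0 (j + n)) (le_max_left _ _) le_rfl)
    exact Prod.mk_le_mk.2 ⟨le_rfl, le_max_right _ _⟩

lemma sigmaTop₁_eq_iSup (i j : ℤ) : sigmaTop₁ ℱ j = ⨆ n : ℕ, ℱ (i + n, j) := by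
  refine le_antisymm (iSup₂_le fun l _ => ?_) (iSup_le fun n => ?_)
  · refine le_trans (ℱ.mono ?_) (le_iSup (fun n : ℕ => ℱ (i + n, j)) (l - i).toNat)
    exact Prod.mk_le_mk.2 ⟨by omega, le_rfl⟩
  · refine le_trans (ℱ.mono (?_ : (i + (n : ℤ), j) ≤ (max 0 (i + n), j)))
      (le_iSup₂_of_le (max 0 (i + n)) (le_max_left _ _) le_rfl)
    exact Prod.mk_le_mk.2 ⟨le_max_right _ _, le_rfl⟩

lemma sigmaTop₂_le (i : ℤ) : sigmaTop₂ ℱ i ≤ mΩ := iSup₂_le fun _ _ => ℱ.le _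

lemma sigmaTop₁_le (j : ℤ) : sigmaTop₁ ℱ j ≤ mΩ := iSup₂_le fun _ _ => ℱ.le _

lemma sigmaTop₂_mono : Monotone (sigmaTop₂ ℱ) := fun _ _ h =>
  iSup₂_mono fun _ _ => ℱ.mono (Prod.mk_le_mk.2 ⟨h, le_rfl⟩)

lemma sigmaTop₁_mono : Monotone (sigmaTop₁ ℱ) := fun _ _ h =>
  iSup₂_mono fun _ _ => ℱ.mono (Prod.mk_le_mk.2 ⟨le_rfl, h⟩)

/-- The filtration `n ↦ ℱ_{i,j+n}`. -/
def rowFiltration (i j : ℤ) : Filtration ℕ mΩ where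
  seq n := ℱ (i, j + n)
  mono' _ _ h := ℱ.mono (Prod.mk_le_mk.2 ⟨le_rfl, by simpa using h⟩)
  le' _ := ℱ.le _

/-- The filtration `n ↦ ℱ_{i+n,j}`. -/
def columnFiltration (i j : ℤ) : Filtration ℕ mΩ where
  seq n := ℱ (i + n, j)
  mono' _ _ h := ℱ.mono (Prod.mk_le_mk.2 ⟨by simpa using h, le_rfl⟩)
  le' _ := ℱ.le _

variable {ℱ}

/-- For a commuting filtration, `E(E(f | ℱ_{i,∞}) | ℱ_{∞,j}) = E(f | ℱ_{i,j})`. -/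
lemma IsCommuting.condExp_condExp [IsProbabilityMeasure μ] (hℱ : IsCommuting ℱ μ) (i j : ℤ)
    {f : Ω → ℝ} (hf : Integrable f μ) :
    μ[μ[f | sigmaTop₂ ℱ i] | sigmaTop₁ ℱ j] =ᵐ[μ] μ[f | ℱ (i, j)] := by
  rw [sigmaTop₁_eq_iSup ℱ i j]
  refine condExp_iSup_of_forall_eq (columnFiltration ℱ i j) fun n => ?_
  symm
  refine ae_eq_condExp_of_forall_setIntegral_eq (ℱ.le (i + n, j)) integrable_condExp
    (fun s _ _ => integrable_condExp.integrableOn) (fun B hB _ => ?_)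
    (stronglyMeasurable_condExp.mono
      (ℱ.mono (Prod.mk_le_mk.2 ⟨by simp, le_rfl⟩))).aestronglyMeasurable
  have hB' : MeasurableSet B := ℱ.le _ B hB
  -- Commutation is assumed for bounded variables only. It is applied to indicators and passed to
  -- the integrable `f` by self-adjointness of conditional expectation.
  set Y : Ω → ℝ := B.indicator 1 with hY
  have hYm : Measurable[ℱ (i + n, j)] Y :=
    Measurable.indicator (@measurable_const ℝ Ω _ (ℱ (i + n, j)) 1) hB
  have hYb : ∀ ω, |Y ω| ≤ 1 := by
    intro ω
    by_cases h : ω ∈ B <;> simp [hY, h]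
  have hYi : Integrable Y μ := (integrable_const 1).indicator hB'
  have hE : μ[Y | sigmaTop₂ ℱ i] =ᵐ[μ] μ[Y | ℱ (i, j)] := by
    rw [sigmaTop₂_eq_iSup ℱ i j]
    refine condExp_iSup_of_forall_eq (rowFiltration ℱ i j) fun l => ?_
    have := hℱ i (j + l) (i + n) j Y hYm ⟨1, hYb⟩
    rwa [min_eq_left (by simp), min_eq_right (by simp)] at this
  have hmul : ∀ g : Ω → ℝ, ∫ ω in B, g ω ∂μ = ∫ ω, Y ω * g ω ∂μ := by
    intro g
    rw [← integral_indicator hB']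
    congr 1
    ext ω
    by_cases h : ω ∈ B <;> simp [hY, h]
  rw [hmul, hmul, integral_mul_condExp_comm (ℱ.le _) hf hYi (Filter.Eventually.of_forall hYb),
    integral_mul_condExp_comm (sigmaTop₂_le ℱ i) hf hYi (Filter.Eventually.of_forall hYb)]
  refine integral_congr_ae ?_
  filter_upwards [hE] with ω h
  rw [h]

variable {T : ℤ × ℤ → Ω ≃ᵐ Ω}

lemma IsCompatible.comap_sigmaTop₂ (h : IsCompatible T ℱ) (i j k : ℤ) :
    (sigmaTop₂ ℱ k).comap (T (i, j)) = sigmaTop₂ ℱ (k + i) := by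
  rw [sigmaTop₂_eq_iSup ℱ k 0, sigmaTop₂_eq_iSup ℱ (k + i) j, MeasurableSpace.comap_iSup]
  congr 1
  ext1 n
  rw [h]
  congr 2
  ring

lemma IsCompatible.comap_sigmaTop₁ (h : IsCompatible T ℱ) (i j k : ℤ) :
    (sigmaTop₁ ℱ k).comap (T (i, j)) = sigmaTop₁ ℱ (k + j) := by
  rw [sigmaTop₁_eq_iSup ℱ 0 k, sigmaTop₁_eq_iSup ℱ i (k + j), MeasurableSpace.comap_iSup]
  congr 1
  ext1 n
  rw [h]
  congr 2
  ring

end Filtration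

/-! ### Conditional expectations and shifts as operators on `L^q` -/

section Lp

variable {q : ℝ≥0∞}

lemma compMeasurePreserving_comp {σ τ υ : Ω ≃ᵐ Ω} (hσ : MeasurePreserving σ μ μ)
    (hτ : MeasurePreserving τ μ μ) (hυ : MeasurePreserving υ μ μ) (h : ∀ ω, υ ω = τ (σ ω))
    (f : Lp ℝ q μ) :
    Lp.compMeasurePreserving υ hυ f
      = Lp.compMeasurePreserving σ hσ (Lp.compMeasurePreserving τ hτ f) := by
  refine Lp.ext ?_
  refine (Lp.coeFn_compMeasurePreserving _ hυ).trans ?_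
  refine Filter.EventuallyEq.trans ?_ (Lp.coeFn_compMeasurePreserving _ hσ).symm
  refine Filter.EventuallyEq.trans ?_
    (hσ.quasiMeasurePreserving.ae_eq_comp (Lp.coeFn_compMeasurePreserving f hτ)).symm
  refine Filter.Eventually.of_forall fun ω => ?_
  simp [h]

variable [hq : Fact (1 ≤ q)] [IsProbabilityMeasure μ]

/-- Conditional expectation as an operator of `L^q`. -/
noncomputable def condExpLp (μ : Measure Ω) (q : ℝ≥0∞) [hq : Fact (1 ≤ q)]
    [IsProbabilityMeasure μ] (m : MeasurableSpace Ω) : Lp ℝ q μ →+ Lp ℝ q μ where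
  toFun f := (MemLp.condExp (m := m) hq.out (Lp.memLp f)).toLp _
  map_zero' := by
    refine Lp.ext ((MemLp.coeFn_toLp _).trans
      (Filter.EventuallyEq.trans ?_ (Lp.coeFn_zero ℝ q μ).symm))
    refine (condExp_congr_ae (Lp.coeFn_zero ℝ q μ)).trans ?_
    rw [condExp_zero]
  map_add' f g := by
    rw [← MemLp.toLp_add, MemLp.toLp_eq_toLp_iff]
    refine (condExp_congr_ae (Lp.coeFn_add f g)).trans ?_
    exact condExp_add ((Lp.memLp f).integrable hq.out) ((Lp.memLp g).integrable hq.out) _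

lemma coeFn_condExpLp (m : MeasurableSpace Ω) (f : Lp ℝ q μ) :
    condExpLp μ q m f =ᵐ[μ] μ[f | m] :=
  MemLp.coeFn_toLp (MemLp.condExp (m := m) hq.out (Lp.memLp f))

lemma condExpLp_comp {m m' : MeasurableSpace Ω} (hm : m ≤ m') (hm' : m' ≤ mΩ) (f : Lp ℝ q μ) :
    condExpLp μ q m (condExpLp μ q m' f) = condExpLp μ q m f := by
  refine Lp.ext ((coeFn_condExpLp _ _).trans
    (Filter.EventuallyEq.trans ?_ (coeFn_condExpLp _ _).symm))
  exact (condExp_congr_ae (coeFn_condExpLp m' f)).trans (condExp_condExp_of_le hm hm')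

lemma condExpLp_comp' {m m' : MeasurableSpace Ω} (hm : m ≤ m') (hm' : m' ≤ mΩ) (f : Lp ℝ q μ) :
    condExpLp μ q m' (condExpLp μ q m f) = condExpLp μ q m f := by
  refine Lp.ext ((coeFn_condExpLp _ _).trans
    (Filter.EventuallyEq.trans ?_ (coeFn_condExpLp _ _).symm))
  refine (condExp_congr_ae (coeFn_condExpLp m f)).trans ?_
  rw [condExp_of_stronglyMeasurable hm' (stronglyMeasurable_condExp.mono hm) integrable_condExp]

lemma norm_condExpLp_le (m : MeasurableSpace Ω) (f : Lp ℝ q μ) : ‖condExpLp μ q m f‖ ≤ ‖f‖ := by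
  rw [Lp.norm_def, Lp.norm_def, eLpNorm_congr_ae (coeFn_condExpLp m f)]
  exact ENNReal.toReal_mono (Lp.eLpNorm_ne_top f) (eLpNorm_condExp_le_eLpNorm _ hq.out)

lemma compMeasurePreserving_condExpLp {Ω : Type*} {m mΩ : MeasurableSpace Ω} {μ : Measure Ω}
    [IsProbabilityMeasure μ] {τ : Ω → Ω} (hτe : MeasurableEmbedding τ)
    (hτ : MeasurePreserving τ μ μ) (hm : m ≤ mΩ) (f : Lp ℝ q μ) :
    Lp.compMeasurePreserving τ hτ (condExpLp μ q m f)
      = condExpLp μ q (m.comap τ) (Lp.compMeasurePreserving τ hτ f) := by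
  refine Lp.ext ?_
  refine (Lp.coeFn_compMeasurePreserving _ hτ).trans ?_
  refine (hτ.quasiMeasurePreserving.ae_eq_comp (coeFn_condExpLp m f)).trans ?_
  refine (condExp_comp_measurePreserving hτe hτ hm ((Lp.memLp f).integrable hq.out)).symm.trans ?_
  exact (condExp_congr_ae (Lp.coeFn_compMeasurePreserving f hτ).symm).trans
    (coeFn_condExpLp _ _).symm

end Lp

end Operators
-- Realisation of the abstract inequality in `L^p`
section Main

variable {Ω : Type u} {mΩ : MeasurableSpace Ω} {μ : Measure Ω}

lemma eLpNorm_eq_ofReal_norm {q : ℝ≥0∞} {g : Ω → ℝ} {x : Lp ℝ q μ} (h : x =ᵐ[μ] g) :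
    eLpNorm g q μ = ENNReal.ofReal ‖x‖ := by
  rw [Lp.norm_def, ENNReal.ofReal_toReal (Lp.eLpNorm_ne_top x), eLpNorm_congr_ae h]

variable {T : ℤ × ℤ → Ω ≃ᵐ Ω} {ℱ : Filtration (ℤ × ℤ) mΩ}

lemma coeFn_shiftSum_shiftSum {q : ℝ≥0∞} [Fact (1 ≤ q)] (hT : IsShiftGroup T μ) {f : Ω → ℝ}
    (hf : MemLp f q μ) (m n : ℕ) :
    (shiftSum (fun i : ℕ => Lp.compMeasurePreserving (T ((i : ℤ), 0)) (hT.measurePreserving _)) m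
      (shiftSum (fun j : ℕ => Lp.compMeasurePreserving (T (0, (j : ℤ))) (hT.measurePreserving _)) n
        (hf.toLp f)) : Lp ℝ q μ) =ᵐ[μ] partialSum T f m n := by
  have e : ∀ i j : ℕ, Lp.compMeasurePreserving (T ((i : ℤ), 0)) (hT.measurePreserving _)
      (Lp.compMeasurePreserving (T (0, (j : ℤ))) (hT.measurePreserving _) (hf.toLp f))
      =ᵐ[μ] fun ω => f (T ((i : ℤ), (j : ℤ)) ω) := by
    intro i j
    rw [← compMeasurePreserving_comp (υ := T ((i : ℤ), (j : ℤ))) (hT.measurePreserving _)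
      (hT.measurePreserving _) (hT.measurePreserving _)]
    · exact (Lp.coeFn_compMeasurePreserving _ _).trans
        ((hT.measurePreserving _).quasiMeasurePreserving.ae_eq_comp hf.coeFn_toLp)
    · intro ω
      rw [← hT.map_add]
      simp
  simp only [shiftSum, map_sum]
  refine (Lp.coeFn_finsetSum _ _).trans ?_
  have h : ∀ᵐ ω ∂μ, ∀ i j : ℕ, Lp.compMeasurePreserving (T ((i : ℤ), 0)) (hT.measurePreserving _)
      (Lp.compMeasurePreserving (T (0, (j : ℤ))) (hT.measurePreserving _) (hf.toLp f)) ω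
      = f (T ((i : ℤ), (j : ℤ)) ω) := ae_all_iff.2 fun i => ae_all_iff.2 fun j => e i j
  have h' : ∀ᵐ ω ∂μ, ∀ i : ℕ, (∑ j ∈ Icc 1 n,
      Lp.compMeasurePreserving (T ((i : ℤ), 0)) (hT.measurePreserving _)
      (Lp.compMeasurePreserving (T (0, (j : ℤ))) (hT.measurePreserving _) (hf.toLp f)) : Lp ℝ q μ) ω
      = ∑ j ∈ Icc 1 n, (Lp.compMeasurePreserving (T ((i : ℤ), 0)) (hT.measurePreserving _)
      (Lp.compMeasurePreserving (T (0, (j : ℤ))) (hT.measurePreserving _) (hf.toLp f)) : Lp ℝ q μ)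
        ω := by
    refine ae_all_iff.2 fun i => ?_
    filter_upwards [Lp.coeFn_finsetSum (Icc 1 n) (fun j : ℕ =>
      (Lp.compMeasurePreserving (T ((i : ℤ), 0)) (hT.measurePreserving _)
      (Lp.compMeasurePreserving (T (0, (j : ℤ))) (hT.measurePreserving _) (hf.toLp f)) :
        Lp ℝ q μ))] with ω hω
    rw [hω, Finset.sum_apply]
  filter_upwards [h, h'] with ω h1 h2
  rw [Finset.sum_apply]
  unfold partialSum
  refine Finset.sum_congr rfl fun i _ => ?_
  rw [h2]
  exact Finset.sum_congr rfl fun j _ => h1 i j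

variable [IsProbabilityMeasure μ]

/-- A one-parameter filtration carried along by a semigroup of shifts is a smooth system on `L^q`,
as soon as `L^q` is 2-smooth along martingale differences. -/
lemma isSmoothSystem_condExpLp {q : ℝ≥0∞} [Fact (1 ≤ q)] {K : ℝ} (hK : 1 ≤ K)
    (hsmooth : ∀ {m : MeasurableSpace Ω}, m ≤ mΩ → ∀ {X Y : Ω → ℝ}, MemLp X q μ → MemLp Y q μ →
      StronglyMeasurable[m] X → μ[Y | m] =ᵐ[μ] 0 →
      (eLpNorm (X + Y) q μ).toReal ^ 2
        ≤ (eLpNorm X q μ).toReal ^ 2 + K * (eLpNorm Y q μ).toReal ^ 2)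
    {G : ℤ → MeasurableSpace Ω} (hG : Monotone G) (hGle : ∀ i, G i ≤ mΩ) {τ : ℕ → Ω ≃ᵐ Ω}
    (hτ : ∀ i, MeasurePreserving (τ i) μ μ) (hτ0 : ∀ ω, τ 0 ω = ω)
    (hτadd : ∀ i j ω, τ (i + j) ω = τ j (τ i ω))
    (hcomap : ∀ (i : ℕ) (j : ℤ), (G j).comap (τ i) = G (j + i)) :
    IsSmoothSystem (fun i => condExpLp μ q (G i))
      (fun i => Lp.compMeasurePreserving (τ i) (hτ i)) K where
  proj_proj i j x := by
    rcases le_total i j with h | h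
    · rw [min_eq_left h]; exact condExpLp_comp (hG h) (hGle j) x
    · rw [min_eq_right h]; exact condExpLp_comp' (hG h) (hGle i) x
  norm_proj_le i x := norm_condExpLp_le _ x
  shift_zero x := by
    refine Lp.ext ((Lp.coeFn_compMeasurePreserving x (hτ 0)).trans ?_)
    exact Filter.Eventually.of_forall fun ω => by simp [hτ0]
  shift_add i j x := compMeasurePreserving_comp _ _ _ (hτadd i j) x
  norm_shift i x := Lp.norm_compMeasurePreserving x (hτ i)
  shift_proj i j x := by
    rw [compMeasurePreserving_condExpLp (τ i).measurableEmbedding (hτ i) (hGle j), hcomap]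
  one_le := hK
  smooth i x y hx hy := by
    -- `P i x = x` makes `x` only almost surely equal to a `G i`-measurable function, so smoothness
    -- is applied to the version `μ[x | G i]`.
    have h := hsmooth (hGle i) (X := μ[x | G i]) (Y := y)
      ((Lp.memLp x).condExp Fact.out) (Lp.memLp y)
      stronglyMeasurable_condExp ?_
    · have ex : (μ[x | G i] : Ω → ℝ) =ᵐ[μ] x := by
        have := coeFn_condExpLp (q := q) (G i) x
        rw [hx] at this
        exact this.symm
      rw [Lp.norm_def, Lp.norm_def, Lp.norm_def, eLpNorm_congr_ae (Lp.coeFn_add x y)]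
      rwa [eLpNorm_congr_ae (ex.add (Filter.EventuallyEq.refl _ _)), eLpNorm_congr_ae ex] at h
    · have := coeFn_condExpLp (q := q) (G i) y
      rw [hy] at this
      exact this.symm.trans (Lp.coeFn_zero ℝ q μ)

/-- The quantity `d_{k,l}(f)` in terms of the operators of `L^q`. -/
lemma projTerm_eq {q : ℝ≥0∞} [hq : Fact (1 ≤ q)] (hℱ : IsCommuting ℱ μ) {f : Ω → ℝ} {k l : ℕ}
    {x : Lp ℝ q μ} (hx : x =ᵐ[μ] partialSum T f k l) :
    projTerm μ T ℱ q f k l =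
      ENNReal.ofReal (rectProjNorm (fun i => condExpLp μ q (sigmaTop₂ ℱ i))
        (fun j => condExpLp μ q (sigmaTop₁ ℱ j)) k l x) := by
  have c1 : ∀ m : MeasurableSpace Ω, condExpLp μ q m x =ᵐ[μ] μ[partialSum T f k l | m] := fun m =>
    (coeFn_condExpLp m x).trans (condExp_congr_ae hx)
  -- The commuting hypothesis enters here: the iterated projection is conditioning on `ℱ (i, j)`.
  have c2 : ∀ i j : ℤ, condExpLp μ q (sigmaTop₁ ℱ j) (condExpLp μ q (sigmaTop₂ ℱ i) x)
      =ᵐ[μ] μ[partialSum T f k l | ℱ (i, j)] := by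
    intro i j
    refine (coeFn_condExpLp _ _).trans ((condExp_congr_ae (coeFn_condExpLp _ x)).trans ?_)
    exact (hℱ.condExp_condExp i j ((Lp.memLp x).integrable hq.out)).trans (condExp_congr_ae hx)
  unfold rectProjNorm
  rw [ENNReal.ofReal_add (by positivity) (norm_nonneg _),
    ENNReal.ofReal_add (by positivity) (norm_nonneg _),
    ENNReal.ofReal_add (norm_nonneg _) (norm_nonneg _)]
  unfold projTerm
  simp only [map_sub]
  refine congr_arg₂ _ (congr_arg₂ _ (congr_arg₂ _ ?_ ?_) ?_) ?_ <;>
    refine eLpNorm_eq_ofReal_norm ?_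
  · exact c2 1 1
  · exact (Lp.coeFn_sub _ _).trans ((c1 _).sub (c2 _ _))
  · exact (Lp.coeFn_sub _ _).trans ((c1 _).sub (c2 _ _))
  · refine (Lp.coeFn_sub _ _).trans ?_
    filter_upwards [Lp.coeFn_sub x (condExpLp μ q (sigmaTop₂ ℱ k) x),
      Lp.coeFn_sub (condExpLp μ q (sigmaTop₁ ℱ l) x)
        (condExpLp μ q (sigmaTop₁ ℱ l) (condExpLp μ q (sigmaTop₂ ℱ k) x)),
      hx, c1 (sigmaTop₂ ℱ k), c1 (sigmaTop₁ ℱ l), c2 k l] with ω h1 h2 h3 h4 h5 h6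
    simp only [Pi.sub_apply, Pi.add_apply, h1, h2, h3, h4, h5, h6]
    ring

end Main
end RandomField

theorem mainTheorem2 (p : ℝ) (hp : 2 ≤ p) :
    ∃ C : ℝ≥0, ∀ (Ω : Type u) (mΩ : MeasurableSpace Ω) (μ : Measure Ω),
      IsProbabilityMeasure μ →
      ∀ (T : ℤ × ℤ → Ω ≃ᵐ Ω) (ℱ : Filtration (ℤ × ℤ) mΩ),
        RandomField.IsShiftGroup T μ →
        RandomField.IsCommuting ℱ μ →
        RandomField.IsCompatible T ℱ →
        ∀ f : Ω → ℝ,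
          MemLp f (ENNReal.ofReal p) μ →
          AEStronglyMeasurable[RandomField.sigmaTopTop ℱ] f μ →
          μ[f | RandomField.sigmaBotTop ℱ] =ᵐ[μ] 0 →
          μ[f | RandomField.sigmaTopBot ℱ] =ᵐ[μ] 0 →
          ∀ m n : ℕ,
            eLpNorm (RandomField.partialSum T f m n) (ENNReal.ofReal p) μ ≤
              (C : ℝ≥0∞) * (m : ℝ≥0∞) ^ (1 / 2 : ℝ) * (n : ℝ≥0∞) ^ (1 / 2 : ℝ) *
                ∑ k ∈ Icc 1 m, ∑ l ∈ Icc 1 n,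
                  RandomField.projTerm μ T ℱ (ENNReal.ofReal p) f k l /
                    ((k : ℝ≥0∞) ^ (3 / 2 : ℝ) * (l : ℝ≥0∞) ^ (3 / 2 : ℝ)) := by
  -- `K` is fixed before the probability space, so the constant depends on `p` alone.
  obtain ⟨K, hK, hsmooth⟩ := RandomField.exists_smooth_const.{u} hp
  refine ⟨Real.toNNReal (160 * √K * (160 * √K)), ?_⟩
  intro Ω mΩ μ _ T ℱ hT hℱ hTℱ f hf _ _ _ m n
  have : Fact (1 ≤ ENNReal.ofReal p) :=
    ⟨by rw [← ENNReal.ofReal_one]; exact ENNReal.ofReal_le_ofReal (by linarith)⟩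
  have hsm := fun {m : MeasurableSpace Ω} => hsmooth (m := m) (μ := μ) inferInstance
  have H₁ := RandomField.isSmoothSystem_condExpLp (q := ENNReal.ofReal p) hK hsm
    (RandomField.sigmaTop₂_mono ℱ) (RandomField.sigmaTop₂_le ℱ)
    (τ := fun i : ℕ => T ((i : ℤ), 0)) (fun i => hT.measurePreserving _) (fun ω => hT.map_zero ω)
    (fun i j ω => by rw [← hT.map_add]; simp [add_comm])
    (fun i j => hTℱ.comap_sigmaTop₂ i 0 j)
  have H₂ := RandomField.isSmoothSystem_condExpLp (q := ENNReal.ofReal p) hK hsm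
    (RandomField.sigmaTop₁_mono ℱ) (RandomField.sigmaTop₁_le ℱ)
    (τ := fun j : ℕ => T (0, (j : ℤ))) (fun i => hT.measurePreserving _) (fun ω => hT.map_zero ω)
    (fun i j ω => by rw [← hT.map_add]; simp [add_comm])
    (fun i j => hTℱ.comap_sigmaTop₁ 0 i j)
  have main := RandomField.norm_shiftSum_shiftSum_le H₁ H₂ ?_ ?_ m n (hf.toLp f)
  · rw [RandomField.eLpNorm_eq_ofReal_norm (RandomField.coeFn_shiftSum_shiftSum hT hf m n)]
    refine (ENNReal.ofReal_le_ofReal main).trans (le_of_eq ?_)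
    have hpow : ∀ (k : ℕ) (r : ℝ), 0 ≤ r →
        (k : ℝ≥0∞) ^ r = ENNReal.ofReal ((k : ℝ) ^ r) := fun k r hr => by
      rw [← ENNReal.ofReal_rpow_of_nonneg (Nat.cast_nonneg k) hr, ENNReal.ofReal_natCast]
    rw [ENNReal.ofReal_mul (by positivity), ENNReal.ofReal_mul (by positivity),
      ENNReal.ofReal_mul (by positivity), Real.sqrt_eq_rpow m, Real.sqrt_eq_rpow n,
      hpow m _ (by norm_num), hpow n _ (by norm_num),
      ENNReal.ofReal_sum_of_nonneg fun k _ => Finset.sum_nonneg fun l _ =>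
        div_nonneg (RandomField.rectProjNorm_nonneg _ _ k l _) (by positivity)]
    refine congr_arg _ (Finset.sum_congr rfl fun k hk => ?_)
    rw [ENNReal.ofReal_sum_of_nonneg fun l _ =>
      div_nonneg (RandomField.rectProjNorm_nonneg _ _ k l _) (by positivity)]
    refine Finset.sum_congr rfl fun l hl => ?_
    -- Indices start at 1, so the weights are positive and division in `ℝ≥0∞` agrees with real
    -- division.
    have hk0 : (0 : ℝ) < k := by exact_mod_cast (mem_Icc.1 hk).1
    have hl0 : (0 : ℝ) < l := by exact_mod_cast (mem_Icc.1 hl).1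
    rw [ENNReal.ofReal_div_of_pos (by positivity), ENNReal.ofReal_mul (by positivity),
      hpow k _ (by norm_num), hpow l _ (by norm_num),
      RandomField.projTerm_eq hℱ (RandomField.coeFn_shiftSum_shiftSum hT hf k l)]
  -- A vertical shift leaves `ℱ_{i,∞}` invariant, so it commutes with conditioning on it.
  · intro i j x
    have := RandomField.compMeasurePreserving_condExpLp (T (0, (j : ℤ))).measurableEmbedding
      (hT.measurePreserving _) (RandomField.sigmaTop₂_le ℱ i) x
    rw [hTℱ.comap_sigmaTop₂ 0 j i, add_zero] at this
    exact this.symm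
  · intro i j x
    rw [← RandomField.compMeasurePreserving_comp (υ := T ((i : ℤ), (j : ℤ)))
        (hT.measurePreserving _) (hT.measurePreserving _) (hT.measurePreserving _),
      ← RandomField.compMeasurePreserving_comp (υ := T ((i : ℤ), (j : ℤ)))
        (hT.measurePreserving _) (hT.measurePreserving _) (hT.measurePreserving _)]
    · intro ω; rw [← hT.map_add]; simp
    · intro ω; rw [← hT.map_add]; simp
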